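/- **Conventions.** $\log$ is the natural logarithm; $\log^* x$ is the number of times $\log_2$ must be applied to $x$ until the value is at most $1$. $\mathrm{Lap}(b)$ has density $\frac1{2b}e^{-|x|/b}$. Data sets are finite multisets. Two data sets $D,D'$ of the same size over a totally ordered set $X$ are *cumulatively adjacent* if $\big||\{x\in D:x\le y\}|-|\{x\in D':x\le y\}|\big|\le 1$ for all $y\in X$. A randomized algorithm $\mathcal A$ on data sets of size $n$ is $(\bar\varepsilon,\bar\delta)$-*cumulatively-DP* if $\Pr[\mathcal A(D)\in F]\le e^{\bar\varepsilon}\Pr[\mathcal A(D')\in F]+\bar\delta$ for all cumulatively adjacent $D,D'$ of size $n$ and all sets $F$ of outcomes. Put $f^D(z)=\min(|\{x\in D:x\le z\}|,|\{x\in D:x\ge z\}|)$. **Mechanisms.** The exponential mechanism with parameter $\varepsilon$ chooses $z\in Z$ with probability proportional to $e^{\varepsilon q(z)/2}$. The choosing mechanism with parameters $\varepsilon,\delta$ (confidence parameter $\delta$, growth bound $1$), for $q:Z\to\mathbb N$: if $\max q+\mathrm{Lap}(4/\varepsilon)<\frac8\varepsilon\log\frac4{\varepsilon\delta^2}$ or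 no $z$ has $q(z)\ge1$, return a fixed element of $Z$; otherwise run the exponential mechanism with parameter $\varepsilon/2$ on $\{z:q(z)\ge 1\}$. **Tree and embedding.** Pad a totally ordered universe $X$ by dummy elements at the end to size $2^k$, $k=\lceil\log_2|X|\rceil$, and let $T$ be the complete binary tree with these leaves, in order. The weight $w(v)$ of a vertex $v$ is the number of data points below it, $w_{\min}(v)$ is the smaller weight of its two children; $v_{\rm left},v_{\rm right}$ are the left-most and right-most leaves below $v$ and $v_{\text{left-right}}$ is the right-most leaf below its left child. The heavy path of $D$ starts at the root (its vertex number $1$) and goes to the heavier child (the left one in a tie) down to a leaf. $\Gamma(D)$ is the maximum of $w_{\min}$ over the inner vertices of the path. $E_{\rm embed}(D)$ labels each $x\in D$ by the number $q\in Y=\{1,\dots,k\}$ of the last inner vertex of the path that $x$ lies below, and lists the pairs $(q,x)$ in decreasing lexicographic order. **OneHeavyRound$(X,D)$.** Draw $\rho'\sim\mathrm{Lap}(1/\varepsilon)$. Follow the heavy path; at an inner vertex $v$ with $w_{\min}(v)>t/10$ and $w_{\min}(v)+\mathrm{Lap}(1/\varepsilon)\ge t/4+\rho'$ (fresh noise each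 time), return $v_{\text{left-right}}$. If a leaf is reached, return it. **Cumulative TreeLog** with parameters $\varepsilon,\delta$ and $t=\lceil\frac{100}\varepsilon\log\frac1\delta\rceil$ (read as $0$ if this is negative): draw $\rho\sim\mathrm{Lap}(1/\varepsilon)$ once and return $\mathrm{NewTreeLog}(X,D)$, where $\mathrm{NewTreeLog}(X,D)$ is: 1. If $|X|\le8$, return the output of the exponential mechanism with parameter $\varepsilon$ on $X$ with score $f^D$. 2. Remove from $D$ the $t$ smallest elements $S_\ell$, then the $t$ largest remaining elements $S_r$, leaving $D^{(2)}$. (Here and below all remaining elements are taken if there are too few.) 3. If $\Gamma(D^{(2)})+\mathrm{Lap}(1/\varepsilon)\ge\frac{3t}4+\rho$, return the output of OneHeavyRound$(X,D^{(2)})$. 4. Otherwise let $S_d$ be the $X$-coordinates of the first $2t$ entries of $E_{\rm embed}(D^{(2)})$ and $D_{\rm new}$ the $Y$-coordinates of the other entries. Let $\hat q=\mathrm{NewTreeLog}(Y,D_{\rm new})$. 5. By the choosing mechanism with parameters $\varepsilon,\delta$ choose a vertex $v$ of $T$ among those of level $\hat q$ (the root has level $1$), with quality its weight with respect to $S_d$.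 Return the output of the exponential mechanism with parameter $\varepsilon$ on $\{v_{\rm left},v_{\rm right},v_{\text{left-right}}\}$ with score $f^{S_\ell\cup S_r}$. In steps 3 and 5 a dummy output is replaced by the largest element of $X$. **Theorem.** For every real polynomial $P$ there is a constant $C>0$, depending only on $P$, such that for every nonempty finite totally ordered set $X$, all $\delta>0$ and $0<\varepsilon<2^{-\log^*|X|}$, and every sample size $n\le t\cdot P(\log^*|X|)$, the Cumulative TreeLog algorithm on data sets of size $n$ over $X$ is $\big(C\,\varepsilon\,2^{\log^*|X|},\;C\,\delta\,2^{\log^*|X|}\big)$-cumulatively-DP. -/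

import Mathlib

open MeasureTheory

/-- The iterated logarithm: the number of times the base-2 logarithm has to be applied to `x`
before the result is at most `1`. -/
noncomputable def logStar (x : ℝ) : ℕ := sInf {k : ℕ | (Real.logb 2)^[k] x ≤ 1}

namespace CumDP

/-! ### Cumulative differential privacy -/

/-- `D` and `D'` have the same size and are of cumulative distance (at most) `d`. -/
def CumDistLE {X : Type*} [LinearOrder X] (d : ℕ) (D D' : Multiset X) : Prop :=
  D.card = D'.card ∧
    ∀ y : X, |(D.countP (fun x => x ≤ y) : ℤ) - (D'.countP (fun x => x ≤ y) : ℤ)| ≤ (d : ℤ)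

/-- Cumulative adjacency of two data sets. -/
def CumAdjacent {X : Type*} [LinearOrder X] (D D' : Multiset X) : Prop := CumDistLE 1 D D'

/-- One direction of `(ε, δ)`-indistinguishability of two output distributions. -/
def Indist {Y : Type*} [MeasurableSpace Y] (ε δ : ℝ) (μ ν : Measure Y) : Prop :=
  ∀ F : Set Y, MeasurableSet F →
    μ F ≤ ENNReal.ofReal (Real.exp ε) * ν F + ENNReal.ofReal δ

/-- The randomized algorithm `A` (a data set is sent to the distribution of the output), on data
sets of size `n`, is `(ε, δ)`-cumulatively DP. The relation `CumAdjacent` is symmetric, so the two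
directions of the inequality are both required. -/
def IsCumDP {X Y : Type*} [LinearOrder X] [MeasurableSpace Y] (n : ℕ) (ε δ : ℝ)
    (A : Multiset X → Measure Y) : Prop :=
  ∀ D D' : Multiset X, D.card = n → D'.card = n → CumAdjacent D D' → Indist ε δ (A D) (A D')

/-! ### Standard mechanisms -/

/-- The Laplace distribution `Lap(b)`. -/
noncomputable def lap (b : ℝ) : Measure ℝ :=
  volume.withDensity fun x => ENNReal.ofReal (1 / (2 * b) * Real.exp (-|x| / b))

/-- The exponential mechanism on the finite solution set `Z`: a solution `z` is chosen with
probability proportional to `exp (ε q(z) / 2)`. -/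
noncomputable def expMech (ε : ℝ) (Z : Finset ℕ) (q : ℕ → ℝ) : Measure ℕ :=
  ∑ z ∈ Z, ENNReal.ofReal
    (Real.exp (ε * q z / 2) / ∑ z' ∈ Z, Real.exp (ε * q z' / 2)) • Measure.dirac z

/-- The choosing mechanism for a `K`-bounded quality function `q`, with privacy parameters `ε, δ`
and confidence parameter `β`: if the optimum plus noise `Lap(4/ε)` is below the threshold
`(8/ε) log(4K/(βεδ))`, the mechanism fails; otherwise it runs the exponential mechanism with
parameter `ε/2` on the solutions of quality at least `1`. On failure, or if there are
no such solutions, the answer is the fixed solution `z₀`. -/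
noncomputable def choosingMech (ε δ β K : ℝ) (Z : Finset ℕ) (q : ℕ → ℕ) (z₀ : ℕ) : Measure ℕ :=
  (lap (4 / ε)).bind fun s =>
    if ((Z.sup q : ℕ) : ℝ) + s < 8 / ε * Real.log (4 * K / (β * ε * δ)) ∨
        Z.filter (fun z => 1 ≤ q z) = ∅ then
      Measure.dirac z₀
    else expMech (ε / 2) (Z.filter (fun z => 1 ≤ q z)) (fun z => (q z : ℝ))

/-! ### The search tree

A totally ordered universe of size `N` is represented by the positions `0, …, N - 1`. It is padded
by dummy elements to `2 ^ k` positions, the leaves of a complete binary tree. The vertex of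
height `h` and index `i` has the leaves `i * 2 ^ h, …, (i + 1) * 2 ^ h - 1` below it; the root is
the vertex of height `k` and index `0`, and the children of the vertex of height `h + 1` and
index `i` are those of height `h` and indices `2 * i` (left) and `2 * i + 1` (right). -/

/-- Number of data points below the vertex of height `h` and index `i`. -/
def weight (D : Multiset ℕ) (h i : ℕ) : ℕ := D.countP (fun x => x / 2 ^ h = i)

/-- Index of the heavier child of the vertex of height `h + 1` and index `i`; ties go left. -/
def heavyChild (D : Multiset ℕ) (h i : ℕ) : ℕ :=
  if weight D h (2 * i + 1) ≤ weight D h (2 * i) then 2 * i else 2 * i + 1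

/-- The smaller of the weights of the two children of the vertex of height `h + 1`, index `i`. -/
def minWeight (D : Multiset ℕ) (h i : ℕ) : ℕ :=
  min (weight D h (2 * i)) (weight D h (2 * i + 1))

/-- Left-most leaf below the vertex of height `h` and index `i`. -/
def leftLeaf (h i : ℕ) : ℕ := i * 2 ^ h

/-- Right-most leaf below the vertex of height `h` and index `i`. -/
def rightLeaf (h i : ℕ) : ℕ := (i + 1) * 2 ^ h - 1

/-- Right-most leaf below the left child of the vertex of height `h + 1` and index `i`. -/
def leftRightLeaf (h i : ℕ) : ℕ := rightLeaf h (2 * i)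

/-- The maximum of `minWeight` along the path of heavier children that starts at the vertex of
height `h` and index `i`. -/
def gammaFrom (D : Multiset ℕ) : ℕ → ℕ → ℕ
  | 0, _ => 0
  | h + 1, i => max (minWeight D h i) (gammaFrom D h (heavyChild D h i))

/-- The balancedness `Γ(D)` for the tree of height `k`. -/
def Gam (k : ℕ) (D : Multiset ℕ) : ℕ := gammaFrom D k 0

/-- The label of `x`: follow the path of heavier children, counting the levels by `q`; the label is
the level of the last vertex on the path that `x` is below. A point on the final leaf shares
its label with the points that leave the path at the parent of the leaf. -/
def labelFrom (D : Multiset ℕ) (x : ℕ) : ℕ → ℕ → ℕ → ℕ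
  | 0, _, q => q - 1
  | h + 1, i, q =>
    if x / 2 ^ h = heavyChild D h i then labelFrom D x h (heavyChild D h i) (q + 1) else q

/-- The embedding into `Y × X`, as a list in decreasing lexicographic order. The labels
`0, …, k - 1` stand for the elements `1, …, k` of `Y`, in this order. -/
def embedList (k : ℕ) (D : Multiset ℕ) : List (ℕ ×ₗ ℕ) :=
  (D.map fun x => toLex (labelFrom D x k 0 0, x)).sort (fun a b => b ≤ a)

/-- The interior point score `min(|{x ∈ D : x ≤ z}|, |{x ∈ D : x ≥ z}|)`. -/
noncomputable def fIPP (D : Multiset ℕ) (z : ℕ) : ℝ :=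
  ((min (D.countP (fun x => x ≤ z)) (D.countP (fun x => z ≤ x)) : ℕ) : ℝ)

/-! ### The algorithms -/

/-- The loop of `OneHeavyRound`, from the vertex of height `h` and index `i`, with threshold
noise `ρ`. -/
noncomputable def heavyWalk (ε : ℝ) (t : ℕ) (D : Multiset ℕ) (ρ : ℝ) : ℕ → ℕ → Measure ℕ
  | 0, i => Measure.dirac i
  | h + 1, i =>
    (lap (1 / ε)).bind fun s =>
      if (t : ℝ) / 10 < (minWeight D h i : ℝ) ∧ (t : ℝ) / 4 + ρ ≤ (minWeight D h i : ℝ) + s then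
        Measure.dirac (leftRightLeaf h i)
      else heavyWalk ε t D ρ h (heavyChild D h i)

/-- `OneHeavyRound`, on the tree of height `k`. -/
noncomputable def oneHeavyRound (ε : ℝ) (t k : ℕ) (D : Multiset ℕ) : Measure ℕ :=
  (lap (1 / ε)).bind fun ρ => heavyWalk ε t D ρ k 0

/-- The trimming parameter `t = (100/ε) log(1/δ)`, rounded up to an integer. -/
noncomputable def trim (ε δ : ℝ) : ℕ := ⌈100 / ε * Real.log (1 / δ)⌉₊

/-- The steps that follow the recursive call on the tree of height `k`, given its answer `q`: the
choosing mechanism finds a vertex `v` of level `q` (the root has level `0`) with a large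
weight in `Sd`, and the exponential mechanism chooses from `v_left, v_right, v_left-right`
according to the score in `Sb`. -/
noncomputable def finishLevel (ε δ : ℝ) (k : ℕ) (Sd Sb : Multiset ℕ) (q : ℕ) : Measure ℕ :=
  (choosingMech ε δ δ 1 (Finset.range (2 ^ q)) (fun i => weight Sd (k - q) i) 0).bind fun i =>
    expMech ε {leftLeaf (k - q) i, rightLeaf (k - q) i, leftRightLeaf (k - q - 1) i} (fIPP Sb)

lemma clog_lt_self {N : ℕ} (h : ¬ N ≤ 8) : Nat.clog 2 N < N := by
  have h1 : Nat.clog 2 N ≤ N - 1 := Nat.clog_le_of_le_pow (by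
    have : N - 1 < 2 ^ (N - 1) := Nat.lt_two_pow_self
    omega)
  omega

/-- `NewTreeLog` on a universe of size `N`, for the trimming parameter `t` and the global threshold
noise `ρ`. The slices have fixed sizes: `Sl` and `Sr` are the `t` smallest elements and then the
`t` largest of the remaining ones, `Sd` consists of the first `2t` elements of the embedded
list, projected to `X`, and the rest of that list, projected to `Y`, is the input of the
recursive call on the universe `Y` of size `k`. An output that is a dummy position is
replaced by the last position `N - 1`. -/
noncomputable def newTreeLog (ε δ : ℝ) (t : ℕ) (ρ : ℝ) (N : ℕ) (D : Multiset ℕ) : Measure ℕ :=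
  if hN : N ≤ 8 then expMech ε (Finset.range N) (fIPP D)
  else
    let k := Nat.clog 2 N
    let L₁ := D.sort (fun a b => a ≤ b)
    let Sl : Multiset ℕ := ↑(L₁.take t)
    let D₁ : Multiset ℕ := ↑(L₁.drop t)
    let L₂ := D₁.sort (fun a b => b ≤ a)
    let Sr : Multiset ℕ := ↑(L₂.take t)
    let D₂ : Multiset ℕ := ↑(L₂.drop t)
    let L₃ := embedList k D₂
    let Sd : Multiset ℕ := ↑((L₃.take (2 * t)).map fun p => (ofLex p).2)
    let Dnew : Multiset ℕ := ↑((L₃.drop (2 * t)).map fun p => (ofLex p).1)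
    ((lap (1 / ε)).bind fun s =>
      if 3 * (t : ℝ) / 4 + ρ ≤ (Gam k D₂ : ℝ) + s then oneHeavyRound ε t k D₂
      else (newTreeLog ε δ t ρ k Dnew).bind (finishLevel ε δ k Sd (Sl + Sr))).map
        fun z => min z (N - 1)
termination_by N
decreasing_by exact clog_lt_self hN

/-- The Cumulative TreeLog algorithm on positions. -/
noncomputable def cumTreeLogPos (ε δ : ℝ) (N : ℕ) (D : Multiset ℕ) : Measure ℕ :=
  (lap (1 / ε)).bind fun ρ => newTreeLog ε δ (trim ε δ) ρ N D

/-- The position of an element in the ordered universe `X`. -/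
noncomputable def pos {X : Type*} [LinearOrder X] [Fintype X] (x : X) : ℕ :=
  ((Fintype.orderIsoFinOfCardEq X rfl).symm x : Fin (Fintype.card X))

/-- The element at a given position (the last element, if the position is too large). -/
noncomputable def ofPos {X : Type*} [LinearOrder X] [Fintype X] [Nonempty X] (z : ℕ) : X :=
  Fintype.orderIsoFinOfCardEq X rfl
    ⟨min z (Fintype.card X - 1),
      lt_of_le_of_lt (min_le_right _ _) (Nat.sub_one_lt Fintype.card_ne_zero)⟩

/-- The Cumulative TreeLog algorithm with parameters `ε` and `δ` on the finite totally ordered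
universe `X`: the distribution of its output on a data set. -/
noncomputable def cumTreeLog (X : Type*) [LinearOrder X] [Fintype X] [Nonempty X]
    [MeasurableSpace X] (ε δ : ℝ) (D : Multiset X) : Measure X :=
  (cumTreeLogPos ε δ (Fintype.card X) (D.map pos)).map ofPos

/-! ### The output is a probability distribution -/

lemma isProbabilityMeasure_lap {b : ℝ} (hb : 0 < b) : IsProbabilityMeasure (lap b) := by
  have h1 : ∫ x in Set.Ioi (0 : ℝ), Real.exp (-x / b) = b := by
    have h2 := integral_exp_mul_Ioi (a := -(1 / b)) (by simpa using hb) 0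
    have h3 : (fun x : ℝ => Real.exp (-x / b)) = fun x => Real.exp (-(1 / b) * x) := by
      funext x; congr 1; ring
    rw [h3, h2]; simp
  have hint : ∫ x : ℝ, 1 / (2 * b) * Real.exp (-|x| / b) = 1 := by
    rw [integral_const_mul, integral_comp_abs (f := fun x : ℝ => Real.exp (-x / b)), h1]
    field_simp
  have hI : Integrable (fun x : ℝ => 1 / (2 * b) * Real.exp (-|x| / b)) := by
    by_contra hn
    rw [integral_undef hn] at hint
    exact zero_ne_one hint
  refine ⟨?_⟩
  rw [lap, withDensity_apply _ MeasurableSet.univ, Measure.restrict_univ,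
    ← ofReal_integral_eq_lintegral_ofReal hI (Filter.Eventually.of_forall fun x => by positivity),
    hint, ENNReal.ofReal_one]

lemma isProbabilityMeasure_expMech (ε : ℝ) {Z : Finset ℕ} (hZ : Z.Nonempty) (q : ℕ → ℝ) :
    IsProbabilityMeasure (expMech ε Z q) := by
  have hpos : 0 < ∑ z' ∈ Z, Real.exp (ε * q z' / 2) :=
    Finset.sum_pos (fun _ _ => Real.exp_pos _) hZ
  refine ⟨?_⟩
  simp only [expMech, Measure.finsetSum_apply, Measure.smul_apply, measure_univ, smul_eq_mul,
    mul_one]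
  rw [← ENNReal.ofReal_sum_of_nonneg (fun _ _ => by positivity), ← Finset.sum_div,
    div_self hpos.ne', ENNReal.ofReal_one]

lemma isProbabilityMeasure_bind' {α β : Type*} [MeasurableSpace α] [MeasurableSpace β]
    {μ : Measure α} [IsProbabilityMeasure μ] {f : α → Measure β} (hf : Measurable f)
    (h : ∀ a, IsProbabilityMeasure (f a)) : IsProbabilityMeasure (μ.bind f) := by
  refine ⟨?_⟩
  rw [Measure.bind_apply MeasurableSet.univ hf.aemeasurable]
  simp

lemma measurable_bind_param {μ : Measure ℝ} [SFinite μ] {f : ℝ → ℝ → Measure ℕ}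
    (hf : Measurable (Function.uncurry f)) : Measurable fun ρ => μ.bind (f ρ) := by
  refine Measure.measurable_of_measurable_coe _ fun s hs => ?_
  have : (fun ρ => μ.bind (f ρ) s) = fun ρ => ∫⁻ x, f ρ x s ∂μ := by
    funext ρ
    exact Measure.bind_apply hs (hf.comp measurable_prodMk_left).aemeasurable
  rw [this]
  exact Measurable.lintegral_prod_right' (f := fun p : ℝ × ℝ => f p.1 p.2 s)
    ((Measure.measurable_coe hs).comp hf)

lemma heavyWalk_props {ε : ℝ} (hε : 0 < ε) (t : ℕ) (D : Multiset ℕ) (h : ℕ) : ∀ i : ℕ,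
    Measurable (fun ρ => heavyWalk ε t D ρ h i) ∧
      ∀ ρ, IsProbabilityMeasure (heavyWalk ε t D ρ h i) := by
  have := isProbabilityMeasure_lap (one_div_pos.2 hε)
  induction h with
  | zero =>
    intro i
    exact ⟨by simpa only [heavyWalk] using measurable_const, fun ρ => by
      rw [heavyWalk]; infer_instance⟩
  | succ h ih =>
    intro i
    obtain ⟨h1, h2⟩ := ih (heavyChild D h i)
    have hm : Measurable (Function.uncurry fun (ρ s : ℝ) =>
        if (t : ℝ) / 10 < (minWeight D h i : ℝ) ∧ (t : ℝ) / 4 + ρ ≤ (minWeight D h i : ℝ) + s then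
          Measure.dirac (leftRightLeaf h i)
        else heavyWalk ε t D ρ h (heavyChild D h i)) := by
      refine Measurable.ite ?_ measurable_const (h1.comp measurable_fst)
      exact (MeasurableSet.const _).inter
        (measurableSet_le (measurable_const.add measurable_fst) (measurable_const.add measurable_snd))
    refine ⟨by simpa only [heavyWalk] using measurable_bind_param hm, fun ρ => ?_⟩
    rw [heavyWalk]
    refine isProbabilityMeasure_bind' (hm.comp measurable_prodMk_left) fun s => ?_
    have := h2 ρ
    change IsProbabilityMeasure (ite _ _ _)
    split_ifs <;> infer_instance

lemma isProbabilityMeasure_oneHeavyRound {ε : ℝ} (hε : 0 < ε) (t k : ℕ) (D : Multiset ℕ) :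
    IsProbabilityMeasure (oneHeavyRound ε t k D) :=
  have := isProbabilityMeasure_lap (one_div_pos.2 hε)
  isProbabilityMeasure_bind' (heavyWalk_props hε t D k 0).1 (heavyWalk_props hε t D k 0).2

lemma isProbabilityMeasure_choosingMech {ε : ℝ} (hε : 0 < ε) (δ β K : ℝ) (Z : Finset ℕ)
    (q : ℕ → ℕ) (z₀ : ℕ) : IsProbabilityMeasure (choosingMech ε δ β K Z q z₀) := by
  have := isProbabilityMeasure_lap (show 0 < 4 / ε by positivity)
  refine isProbabilityMeasure_bind' (Measurable.ite ?_ measurable_const measurable_const)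
    fun s => ?_
  · exact (measurableSet_lt (measurable_const.add measurable_id) measurable_const).union (MeasurableSet.const _)
  · split_ifs with h
    · infer_instance
    · exact isProbabilityMeasure_expMech _ (Finset.nonempty_iff_ne_empty.2 (not_or.1 h).2) _

lemma isProbabilityMeasure_finishLevel {ε : ℝ} (hε : 0 < ε) (δ : ℝ) (k : ℕ)
    (Sd Sb : Multiset ℕ) (q : ℕ) : IsProbabilityMeasure (finishLevel ε δ k Sd Sb q) :=
  have := isProbabilityMeasure_choosingMech hε δ δ 1 (Finset.range (2 ^ q))
    (fun i => weight Sd (k - q) i) 0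
  isProbabilityMeasure_bind' Measurable.of_discrete fun _ =>
    isProbabilityMeasure_expMech _ (Finset.insert_nonempty _ _) _

lemma newTreeLog_props {ε : ℝ} (hε : 0 < ε) (δ : ℝ) (t N : ℕ) : 0 < N → ∀ D : Multiset ℕ,
    Measurable (fun ρ => newTreeLog ε δ t ρ N D) ∧
      ∀ ρ, IsProbabilityMeasure (newTreeLog ε δ t ρ N D) := by
  have := isProbabilityMeasure_lap (one_div_pos.2 hε)
  induction N using Nat.strong_induction_on with
  | _ N ih =>
  intro hN D
  by_cases h8 : N ≤ 8
  · refine ⟨?_, fun ρ => ?_⟩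
    · have : (fun ρ => newTreeLog ε δ t ρ N D) =
          fun _ => expMech ε (Finset.range N) (fIPP D) := by
        funext ρ; rw [newTreeLog, dif_pos h8]
      rw [this]; exact measurable_const
    · rw [newTreeLog, dif_pos h8]
      exact isProbabilityMeasure_expMech _ (Finset.nonempty_range_iff.2 hN.ne') _
  · have hk := ih _ (clog_lt_self h8) (Nat.clog_pos one_lt_two (by omega))
    have key : ∀ (c : ℝ) (Dn D₂ : Multiset ℕ) (f : ℕ → Measure ℕ),
        (∀ q, IsProbabilityMeasure (f q)) →
        Measurable (fun ρ => ((lap (1 / ε)).bind fun s =>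
          if 3 * (t : ℝ) / 4 + ρ ≤ c + s then oneHeavyRound ε t (Nat.clog 2 N) D₂
          else (newTreeLog ε δ t ρ (Nat.clog 2 N) Dn).bind f).map fun z => min z (N - 1)) ∧
        ∀ ρ, IsProbabilityMeasure (((lap (1 / ε)).bind fun s =>
          if 3 * (t : ℝ) / 4 + ρ ≤ c + s then oneHeavyRound ε t (Nat.clog 2 N) D₂
          else (newTreeLog ε δ t ρ (Nat.clog 2 N) Dn).bind f).map fun z => min z (N - 1)) := by
      intro c Dn D₂ f hf
      obtain ⟨h1, h2⟩ := hk Dn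
      have hm : Measurable (Function.uncurry fun (ρ s : ℝ) =>
          if 3 * (t : ℝ) / 4 + ρ ≤ c + s then oneHeavyRound ε t (Nat.clog 2 N) D₂
          else (newTreeLog ε δ t ρ (Nat.clog 2 N) Dn).bind f) := by
        refine Measurable.ite (measurableSet_le
          (measurable_const.add measurable_fst) (measurable_const.add measurable_snd))
          measurable_const ?_
        exact (Measure.measurable_bind' Measurable.of_discrete).comp (h1.comp measurable_fst)
      refine ⟨(Measure.measurable_map _ Measurable.of_discrete).comp
        (measurable_bind_param hm), fun ρ => ?_⟩
      have : IsProbabilityMeasure ((lap (1 / ε)).bind fun s =>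
          if 3 * (t : ℝ) / 4 + ρ ≤ c + s then oneHeavyRound ε t (Nat.clog 2 N) D₂
          else (newTreeLog ε δ t ρ (Nat.clog 2 N) Dn).bind f) := by
        refine isProbabilityMeasure_bind' (hm.comp measurable_prodMk_left) fun s => ?_
        have := h2 ρ
        change IsProbabilityMeasure (ite _ _ _)
        split_ifs
        · exact isProbabilityMeasure_oneHeavyRound hε _ _ _
        · exact isProbabilityMeasure_bind' Measurable.of_discrete hf
      exact Measure.isProbabilityMeasure_map (Measurable.of_discrete.aemeasurable)
    have hu : ∀ ρ, newTreeLog ε δ t ρ N D = _ := fun ρ => by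
      rw [newTreeLog, dif_neg h8]
    refine ⟨?_, fun ρ => ?_⟩
    · simp only [hu]
      exact (key _ _ _ _ fun q => isProbabilityMeasure_finishLevel hε _ _ _ _ q).1
    · rw [hu]
      exact (key _ _ _ _ fun q => isProbabilityMeasure_finishLevel hε _ _ _ _ q).2 ρ

/-- The algorithm is a randomized algorithm: its output is a probability distribution. -/
theorem isProbabilityMeasure_cumTreeLog (X : Type*) [LinearOrder X] [Fintype X] [Nonempty X]
    [MeasurableSpace X] {ε : ℝ} (hε : 0 < ε) (δ : ℝ) (D : Multiset X) :
    IsProbabilityMeasure (cumTreeLog X ε δ D) := by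
  have := isProbabilityMeasure_lap (one_div_pos.2 hε)
  have hp := newTreeLog_props hε δ (trim ε δ) (Fintype.card X) Fintype.card_pos (D.map pos)
  have : IsProbabilityMeasure (cumTreeLogPos ε δ (Fintype.card X) (D.map pos)) :=
    isProbabilityMeasure_bind' hp.1 hp.2
  exact Measure.isProbabilityMeasure_map (Measurable.of_discrete.aemeasurable)

end CumDP

namespace CumDP

/-! ### Indistinguishability of distributions and its composition -/

open scoped ENNReal

/-! The induction follows the cumulative distance `d` of the two inputs (`TailClose d`). Counts in
intervals change by at most `2 * d`, hence so do subtree weights and `Γ`, while trimming preserves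
`d`. One level of the recursion costs a privacy loss `O(d ε)` and hands data sets of distance at
most `2 * d` to the next level. The losses form a geometric series of size `O(ε 2 ^ r)` for
recursion depth `r`, and `r ≤ log^*`.

The unstable object is the heavy path. Two heavy paths part only at a vertex whose children are
balanced up to `4 * d`, so that the weight there is at most `2 Γ + 4 * d` (`exists_commonPath`). The
noisy test of `Γ` separates two regimes.

If `Γ` is at most `17t/20`, the points below the vertex of parting all fall into the slice of size
`2t`. The surviving labels depend on common vertices only, so they have distance at most `2 * d`
(`TailClose.tailLabels`). The slice is ordered differently for the two data sets, but merging the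
labels beyond the parting gives a common order (`truncKey`) whose upper sets are unions of two
intervals. Hence subtree weights in the slice change by at most `16 * d`
(`TailClose.weight_headSlice`), which the choosing mechanism tolerates (`close_choosingMech`).

If `Γ` is at least `9t/20`, the paths agree down to a vertex at which `OneHeavyRound` almost surely
stops, and a sparse-vector argument works along the common part (`close_heavyWalk`). The bound on
the sample size is needed here: each vertex that passes the filter `t/10` for only one data set adds
an error `δ`, and each removes more than `t/20` points from the path. The two regimes overlap, and
outside its regime a branch is entered with probability at most `δ`.

These estimates are combined in `close_newTreeLog`. The global noise `ρ` is never shifted; it is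
held fixed in both runs, and only `|ρ| ≤ t/20` matters. The factors polynomial in `log^*` in the
additive error are absorbed by `2 ^ log^*`. -/

/-- `(log c, e)`-indistinguishability in one direction, tested on `[0, 1]`-valued functions. -/
def Close {Y : Type*} [MeasurableSpace Y] (c e : ℝ≥0∞) (μ ν : Measure Y) : Prop :=
  ∀ g : Y → ℝ≥0∞, Measurable g → (∀ y, g y ≤ 1) → ∫⁻ y, g y ∂μ ≤ c * ∫⁻ y, g y ∂ν + e

lemma lintegral_le_one {Y : Type*} [MeasurableSpace Y] (μ : Measure Y) [IsProbabilityMeasure μ]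
    {g : Y → ℝ≥0∞} (hg : ∀ y, g y ≤ 1) : ∫⁻ y, g y ∂μ ≤ 1 := by
  calc ∫⁻ y, g y ∂μ ≤ ∫⁻ _, 1 ∂μ := lintegral_mono hg
    _ = 1 := by simp

/-- Discards a bad event `B`: on it the integrand is bounded by `1`, which costs the probability of
`B`. -/
lemma lintegral_le_indicator {Y : Type*} [MeasurableSpace Y] (μ : Measure Y)
    [IsProbabilityMeasure μ] {G H : Y → ℝ≥0∞} {e β : ℝ≥0∞} {B : Set Y} (hB : MeasurableSet B)
    (hβ : μ B ≤ β) (hG : ∀ y, G y ≤ 1) (hH : Measurable H) (h : ∀ y, y ∉ B → G y ≤ H y + e) :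
    ∫⁻ y, G y ∂μ ≤ ∫⁻ y, H y ∂μ + (e + β) := by
  calc ∫⁻ y, G y ∂μ ≤ ∫⁻ y, (H y + (e + B.indicator 1 y)) ∂μ := by
        refine lintegral_mono fun y => ?_
        by_cases hy : y ∈ B
        · simp only [Set.indicator_of_mem hy, Pi.one_apply]
          exact (hG y).trans (le_add_left (le_add_left le_rfl))
        · simpa [Set.indicator_of_notMem hy] using h y hy
    _ = ∫⁻ y, H y ∂μ + (e + μ B) := by
        rw [lintegral_add_left hH, lintegral_add_left measurable_const]
        simp [lintegral_indicator_one hB]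
    _ ≤ _ := by gcongr

namespace Close

variable {Y : Type*} [MeasurableSpace Y] {c c' e e' : ℝ≥0∞} {μ ν : Measure Y}

lemma mono (h : Close c e μ ν) (hc : c ≤ c') (he : e ≤ e') : Close c' e' μ ν :=
  fun g hg h1 => (h g hg h1).trans (by gcongr)

lemma of_one_le [IsProbabilityMeasure μ] (he : 1 ≤ e) : Close c e μ ν := fun _ _ h1 =>
  (lintegral_le_one μ h1).trans (he.trans le_add_self)

lemma map {Z : Type*} [MeasurableSpace Z] {f : Y → Z} (hf : Measurable f) (h : Close c e μ ν) :
    Close c e (μ.map f) (ν.map f) := fun g hg h1 => by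
  rw [lintegral_map hg hf, lintegral_map hg hf]
  exact h _ (hg.comp hf) fun _ => h1 _

lemma bind [IsProbabilityMeasure μ] {Z : Type*} [MeasurableSpace Z] {f f' : Y → Measure Z}
    (hf : Measurable f) (hf' : Measurable f') (hp : ∀ y, IsProbabilityMeasure (f y))
    (h : Close c e μ ν) (hff : ∀ y, Close c' e' (f y) (f' y)) :
    Close (c * c') (e + e') (μ.bind f) (ν.bind f') := fun g hg h1 => by
  rw [Measure.lintegral_bind hf.aemeasurable hg.aemeasurable,
    Measure.lintegral_bind hf'.aemeasurable hg.aemeasurable]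
  have hm' : Measurable fun y => ∫⁻ z, g z ∂(f' y) := (Measure.measurable_lintegral hg).comp hf'
  -- The cut-off at `1` makes this an admissible test function for the first stage. The error `e'`
  -- is split off beforehand, so it is not multiplied by `c`.
  have hm : Measurable fun y => min 1 (c' * ∫⁻ z, g z ∂(f' y)) :=
    measurable_const.min (hm'.const_mul _)
  calc ∫⁻ y, ∫⁻ z, g z ∂(f y) ∂μ
      ≤ ∫⁻ y, min 1 (c' * ∫⁻ z, g z ∂(f' y)) + e' ∂μ := by
        refine lintegral_mono fun y => ?_
        have := hp y
        rw [← min_add_add_right]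
        exact le_min ((lintegral_le_one _ h1).trans le_self_add) (hff y g hg h1)
    _ = ∫⁻ y, min 1 (c' * ∫⁻ z, g z ∂(f' y)) ∂μ + e' := by
        rw [lintegral_add_left hm]; simp
    _ ≤ c * ∫⁻ y, min 1 (c' * ∫⁻ z, g z ∂(f' y)) ∂ν + e + e' := by
        gcongr; exact h _ hm fun _ => min_le_left _ _
    _ ≤ c * ∫⁻ y, (c' * ∫⁻ z, g z ∂(f' y)) ∂ν + e + e' := by
        gcongr; exact min_le_right _ _
    _ = _ := by rw [lintegral_const_mul _ hm', add_assoc, mul_assoc]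

lemma indist {ε δ : ℝ} (h : Close (ENNReal.ofReal (Real.exp ε)) (ENNReal.ofReal δ) μ ν) :
    Indist ε δ μ ν := fun F hF => by
  have := h (F.indicator 1) (measurable_one.indicator hF) fun y =>
    Set.indicator_le_self' (fun _ _ => zero_le) y
  simpa [lintegral_indicator_one hF] using this

end Close

/-- The multiplicative factor `exp a` of the privacy loss `a`. -/
noncomputable def lossFactor (a : ℝ) : ℝ≥0∞ := ENNReal.ofReal (Real.exp a)

lemma lossFactor_add (a b : ℝ) : lossFactor (a + b) = lossFactor a * lossFactor b := by
  rw [lossFactor, Real.exp_add, ENNReal.ofReal_mul (Real.exp_pos _).le]; rfl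

lemma lossFactor_mono {a b : ℝ} (h : a ≤ b) : lossFactor a ≤ lossFactor b :=
  ENNReal.ofReal_le_ofReal (Real.exp_le_exp.2 h)

/-! ### The Laplace distribution -/

lemma measurable_lap_density (b : ℝ) :
    Measurable fun x : ℝ => ENNReal.ofReal (1 / (2 * b) * Real.exp (-|x| / b)) := by
  fun_prop

lemma lintegral_lap {b : ℝ} {g : ℝ → ℝ≥0∞} (hg : Measurable g) :
    ∫⁻ x, g x ∂(lap b) =
      ∫⁻ x, ENNReal.ofReal (1 / (2 * b) * Real.exp (-|x| / b)) * g x := by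
  rw [lap, lintegral_withDensity_eq_lintegral_mul _ (measurable_lap_density b) hg]
  rfl

/-- Translation by `a` changes the density by a factor of at most `exp (|a| / b)`, by the triangle
inequality. -/
lemma lintegral_lap_le_shift {b : ℝ} (hb : 0 < b) {g : ℝ → ℝ≥0∞} (hg : Measurable g) (a : ℝ) :
    ∫⁻ x, g (x + a) ∂(lap b) ≤ lossFactor (|a| / b) * ∫⁻ x, g x ∂(lap b) := by
  have hg' : Measurable fun x => g (x + a) := hg.comp (measurable_add_const a)
  rw [lintegral_lap hg', lintegral_lap hg, ← lintegral_const_mul _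
      (show Measurable fun x => _ * g x from (measurable_lap_density b).mul hg),
    ← lintegral_add_right_eq_self (μ := volume) (fun x => lossFactor (|a| / b) *
      (ENNReal.ofReal (1 / (2 * b) * Real.exp (-|x| / b)) * g x)) a]
  refine lintegral_mono fun x => ?_
  simp only
  rw [← mul_assoc]
  gcongr
  rw [lossFactor, ← ENNReal.ofReal_mul (Real.exp_pos _).le]
  refine ENNReal.ofReal_le_ofReal ?_
  rw [mul_left_comm, ← Real.exp_add, ← add_div]
  gcongr
  linarith [abs_add_le x a]

lemma lap_shift_le {b : ℝ} (hb : 0 < b) {A B : Set ℝ} (hA : MeasurableSet A)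
    (hB : MeasurableSet B) (a : ℝ) (h : ∀ x ∈ A, x + a ∈ B) :
    lap b A ≤ lossFactor (|a| / b) * lap b B := by
  rw [← lintegral_indicator_one hA, ← lintegral_indicator_one hB]
  refine le_trans (lintegral_mono fun x => ?_)
    (lintegral_lap_le_shift hb (measurable_one.indicator hB) a)
  by_cases hx : x ∈ A
  · simp [hx, h x hx]
  · simp [hx]

lemma lap_shift_const_le {b η : ℝ} (hb : 0 < b) {A B : Set ℝ} (hA : MeasurableSet A)
    (hB : MeasurableSet B) (a : ℝ) (h : ∀ x ∈ A, x + a ∈ B) (ha : |a| / b ≤ η) :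
    lap b A ≤ lossFactor η * lap b B :=
  (lap_shift_le hb hA hB a h).trans (by gcongr; exact lossFactor_mono ha)

/-- On `A` the density at `x` is exactly `exp (-|a| / b)` times the density at `x + a`, and the
translated density has total mass `1`. Both tails are the case of a move by `a` towards the origin.
-/
lemma lap_tail_aux {b : ℝ} (hb : 0 < b) {A : Set ℝ} (hA : MeasurableSet A) (a : ℝ)
    (h : ∀ x ∈ A, |x| = |x + a| + |a|) : lap b A ≤ lossFactor (-|a| / b) := by
  rw [← lintegral_indicator_one hA, lintegral_lap (measurable_one.indicator hA)]
  have h1 : ∫⁻ x, ENNReal.ofReal (1 / (2 * b) * Real.exp (-|x| / b)) = 1 := by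
    have := (isProbabilityMeasure_lap hb).measure_univ
    rwa [lap, withDensity_apply _ MeasurableSet.univ, Measure.restrict_univ] at this
  calc _ ≤ ∫⁻ x, lossFactor (-|a| / b) *
        ENNReal.ofReal (1 / (2 * b) * Real.exp (-|x + a| / b)) := by
        refine lintegral_mono fun x => ?_
        by_cases hx : x ∈ A
        · simp only [Set.indicator_of_mem hx, Pi.one_apply, mul_one]
          rw [lossFactor, ← ENNReal.ofReal_mul (Real.exp_pos _).le, mul_left_comm, ← Real.exp_add,
            ← add_div, h x hx]
          apply le_of_eq; congr 4; ring
        · simp [hx]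
    _ = lossFactor (-|a| / b) *
        ∫⁻ x, ENNReal.ofReal (1 / (2 * b) * Real.exp (-|x + a| / b)) :=
        lintegral_const_mul _ (by fun_prop)
    _ = _ := by
        rw [lintegral_add_right_eq_self (μ := volume)
          (fun x => ENNReal.ofReal (1 / (2 * b) * Real.exp (-|x| / b))) a, h1, mul_one]

lemma lap_upper_tail {b : ℝ} (hb : 0 < b) {A : Set ℝ} (hA : MeasurableSet A) {u : ℝ} (hu : 0 ≤ u)
    (h : ∀ x ∈ A, u ≤ x) : lap b A ≤ lossFactor (-u / b) := by
  have := lap_tail_aux hb hA (-u) fun x hx => by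
    have := h x hx
    rw [abs_of_nonneg (by linarith), abs_of_nonneg (by linarith), abs_neg, abs_of_nonneg hu]; ring
  rwa [abs_neg, abs_of_nonneg hu] at this

lemma lap_lower_tail {b : ℝ} (hb : 0 < b) {A : Set ℝ} (hA : MeasurableSet A) {u : ℝ} (hu : 0 ≤ u)
    (h : ∀ x ∈ A, x ≤ -u) : lap b A ≤ lossFactor (-u / b) := by
  have := lap_tail_aux hb hA u fun x hx => by
    have := h x hx
    rw [abs_of_nonpos (by linarith), abs_of_nonpos (by linarith), abs_of_nonneg hu]; ring
  rwa [abs_of_nonneg hu] at this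

/-! ### Mixtures -/

lemma lintegral_bind_ite {S Y : Type*} [MeasurableSpace S] [MeasurableSpace Y] (κ : Measure S)
    {p : S → Prop} [DecidablePred p] (hp : MeasurableSet {s | p s}) (μ ν : Measure Y)
    {g : Y → ℝ≥0∞} (hg : Measurable g) :
    ∫⁻ y, g y ∂(κ.bind fun s => if p s then μ else ν) =
      κ {s | p s} * ∫⁻ y, g y ∂μ + κ {s | ¬ p s} * ∫⁻ y, g y ∂ν := by
  rw [Measure.lintegral_bind (Measurable.ite hp measurable_const measurable_const).aemeasurable
    hg.aemeasurable]
  have : ∀ s, ∫⁻ y, g y ∂(if p s then μ else ν) =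
      ({s | p s}.indicator (fun _ => ∫⁻ y, g y ∂μ) s +
        {s | ¬ p s}.indicator (fun _ => ∫⁻ y, g y ∂ν) s) := fun s => by
    by_cases h : p s <;> simp [h]
  simp_rw [this]
  have hn : MeasurableSet {s | ¬ p s} := hp.compl
  rw [lintegral_add_left (measurable_const.indicator hp), lintegral_indicator_const hp,
    lintegral_indicator_const hn, mul_comm, mul_comm (lintegral ν g)]

lemma measure_add_not {S : Type*} [MeasurableSpace S] (κ : Measure S) [IsProbabilityMeasure κ]
    {p : S → Prop} (hp : MeasurableSet {s | p s}) : κ {s | p s} + κ {s | ¬ p s} = 1 := by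
  have := measure_add_measure_compl (μ := κ) hp
  rwa [measure_univ] at this

/-! ### The exponential mechanism -/

lemma lintegral_expMech (ε : ℝ) (Z : Finset ℕ) (q : ℕ → ℝ) (g : ℕ → ℝ≥0∞) :
    ∫⁻ z, g z ∂(expMech ε Z q) = ∑ z ∈ Z, ENNReal.ofReal
      (Real.exp (ε * q z / 2) / ∑ z' ∈ Z, Real.exp (ε * q z' / 2)) * g z := by
  rw [expMech, lintegral_finsetSum_measure]
  simp [lintegral_smul_measure]

/-- The numerator and the normalising sum each change by a factor of at most `exp (ε η / 2)`. -/
lemma close_expMech {ε η : ℝ} (hε : 0 ≤ ε) (Z : Finset ℕ) {q q' : ℕ → ℝ}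
    (h : ∀ z ∈ Z, |q z - q' z| ≤ η) :
    Close (lossFactor (ε * η)) 0 (expMech ε Z q) (expMech ε Z q') := fun g _ _ => by
  rw [lintegral_expMech, lintegral_expMech, add_zero, Finset.mul_sum]
  refine Finset.sum_le_sum fun z hz => ?_
  rw [← mul_assoc]
  gcongr
  rw [lossFactor, ← ENNReal.ofReal_mul (Real.exp_pos _).le]
  refine ENNReal.ofReal_le_ofReal ?_
  have hS : 0 < ∑ z' ∈ Z, Real.exp (ε * q z' / 2) :=
    Finset.sum_pos (fun _ _ => Real.exp_pos _) ⟨z, hz⟩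
  have hS' : 0 < ∑ z' ∈ Z, Real.exp (ε * q' z' / 2) :=
    Finset.sum_pos (fun _ _ => Real.exp_pos _) ⟨z, hz⟩
  have h1 : ∀ w ∈ Z, Real.exp (ε * q' w / 2) ≤
      Real.exp (ε * η / 2) * Real.exp (ε * q w / 2) := fun w hw => by
    rw [← Real.exp_add]
    refine Real.exp_le_exp.2 ?_
    have := mul_le_mul_of_nonneg_left ((abs_le.1 (h w hw)).1) hε
    linarith
  have h2 : Real.exp (ε * q z / 2) ≤ Real.exp (ε * η / 2) * Real.exp (ε * q' z / 2) := by
    rw [← Real.exp_add]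
    refine Real.exp_le_exp.2 ?_
    have := mul_le_mul_of_nonneg_left ((abs_le.1 (h z hz)).2) hε
    linarith
  have h3 : ∑ z' ∈ Z, Real.exp (ε * q' z' / 2) ≤
      Real.exp (ε * η / 2) * ∑ z' ∈ Z, Real.exp (ε * q z' / 2) := by
    rw [Finset.mul_sum]; exact Finset.sum_le_sum h1
  have h4 : Real.exp (ε * η) = Real.exp (ε * η / 2) * Real.exp (ε * η / 2) := by
    rw [← Real.exp_add]; congr 1; ring
  rw [← mul_div_assoc, div_le_div_iff₀ hS hS', h4]
  calc _ ≤ (Real.exp (ε * η / 2) * Real.exp (ε * q' z / 2)) *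
        (Real.exp (ε * η / 2) * ∑ z' ∈ Z, Real.exp (ε * q z' / 2)) := by gcongr
    _ = _ := by ring

/-! ### Slices of sorted lists -/

/-- The hypothesis says that the elements satisfying `U` form an initial segment of `L`. -/
lemma countP_take_of_pairwise {α : Type*} (U : α → Prop) [DecidablePred U] : ∀ (L : List α) (T : ℕ),
    L.Pairwise (fun a b => U b → U a) →
      Multiset.countP U ↑(L.take T) = min T (Multiset.countP U ↑L)
  | [], T, _ => by simp
  | a :: L, 0, _ => by simp
  | a :: L, T + 1, h => by
    obtain ⟨h1, h2⟩ := List.pairwise_cons.1 h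
    have ih := countP_take_of_pairwise U L T h2
    rw [List.take_succ_cons, ← Multiset.cons_coe, ← Multiset.cons_coe]
    by_cases ha : U a
    · rw [Multiset.countP_cons_of_pos _ ha, Multiset.countP_cons_of_pos _ ha, ih]; omega
    · have h0 : Multiset.countP U ↑L = 0 :=
        Multiset.countP_eq_zero.2 fun b hb hU => ha (h1 b hb hU)
      rw [Multiset.countP_cons_of_neg _ ha, Multiset.countP_cons_of_neg _ ha, ih, h0]; simp

lemma countP_take_add_drop {α : Type*} (U : α → Prop) [DecidablePred U] (L : List α) (T : ℕ) :
    Multiset.countP U ↑(L.take T) + Multiset.countP U ↑(L.drop T) = Multiset.countP U ↑L := by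
  rw [← Multiset.countP_add, Multiset.coe_add, List.take_append_drop]

lemma countP_drop_of_pairwise {α : Type*} (U : α → Prop) [DecidablePred U] (L : List α) (T : ℕ)
    (h : L.Pairwise (fun a b => U b → U a)) :
    Multiset.countP U ↑(L.drop T) = Multiset.countP U ↑L - T := by
  have h1 := countP_take_of_pairwise U L T h
  have h2 := countP_take_add_drop U L T
  omega

lemma countP_le_of_imp {α : Type*} {p q : α → Prop} [DecidablePred p] [DecidablePred q]
    (D : Multiset α) (h : ∀ x ∈ D, p x → q x) : D.countP p ≤ D.countP q := by
  rw [Multiset.countP_eq_card_filter, Multiset.countP_eq_card_filter]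
  refine Multiset.card_le_card ?_
  rw [Multiset.le_filter]
  exact ⟨Multiset.filter_le _ _, fun a ha => h a (Multiset.mem_filter.1 ha).1 (Multiset.mem_filter.1 ha).2⟩

lemma countP_congr_mem {α : Type*} {p q : α → Prop} [DecidablePred p] [DecidablePred q]
    (D : Multiset α) (h : ∀ x ∈ D, p x ↔ q x) : D.countP p = D.countP q :=
  le_antisymm (countP_le_of_imp D fun x hx => (h x hx).1)
    (countP_le_of_imp D fun x hx => (h x hx).2)

lemma countP_split {α : Type*} (D : Multiset α) {p q r : α → Prop} [DecidablePred p]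
    [DecidablePred q] [DecidablePred r] (h : ∀ x ∈ D, p x ↔ (q x ∨ r x))
    (hd : ∀ x ∈ D, ¬ (q x ∧ r x)) : D.countP p = D.countP q + D.countP r := by
  induction D using Multiset.induction_on with
  | empty => simp
  | cons a D ih =>
    have ih := ih (fun x hx => h x (Multiset.mem_cons_of_mem hx))
      (fun x hx => hd x (Multiset.mem_cons_of_mem hx))
    have h1 := h a (Multiset.mem_cons_self a D)
    have h2 := hd a (Multiset.mem_cons_self a D)
    rw [Multiset.countP_cons, Multiset.countP_cons, Multiset.countP_cons, ih]
    by_cases hq : q a <;> by_cases hr : r a <;> simp_all <;> omega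

/-! ### Cumulative distance on the natural numbers -/

/-- Data sets of natural numbers of the same size and of cumulative distance at most `d`, in terms
of the upper tails. -/
def TailClose (d : ℕ) (D D' : Multiset ℕ) : Prop :=
  D.card = D'.card ∧ ∀ a, D.countP (fun x => a ≤ x) ≤ D'.countP (fun x => a ≤ x) + d ∧
    D'.countP (fun x => a ≤ x) ≤ D.countP (fun x => a ≤ x) + d

lemma countP_le_add_countP_succ_le (D : Multiset ℕ) (y : ℕ) :
    D.countP (fun x => x ≤ y) + D.countP (fun x => y + 1 ≤ x) = D.card := by
  rw [← countP_split D (p := fun _ => True) (fun x _ => by simp; omega) (fun x _ => by omega)]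
  simp

lemma countP_zero_le (D : Multiset ℕ) : D.countP (fun x => 0 ≤ x) = D.card := by
  simp

namespace TailClose

variable {d : ℕ} {D D' : Multiset ℕ}

lemma symm (h : TailClose d D D') : TailClose d D' D := ⟨h.1.symm, fun a => (h.2 a).symm⟩

lemma countP_le (h : TailClose d D D') (y : ℕ) :
    D.countP (fun x => x ≤ y) ≤ D'.countP (fun x => x ≤ y) + d := by
  have h1 := countP_le_add_countP_succ_le D y
  have h2 := countP_le_add_countP_succ_le D' y
  have h3 := h.2 (y + 1)
  have := h.1
  omega

lemma of_countP_le (hc : D.card = D'.card)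
    (h : ∀ y, D.countP (fun x => x ≤ y) ≤ D'.countP (fun x => x ≤ y) + d ∧
      D'.countP (fun x => x ≤ y) ≤ D.countP (fun x => x ≤ y) + d) : TailClose d D D' := by
  refine ⟨hc, fun a => ?_⟩
  rcases a with _ | a
  · rw [countP_zero_le, countP_zero_le]; omega
  · have h1 := countP_le_add_countP_succ_le D a
    have h2 := countP_le_add_countP_succ_le D' a
    have h3 := h a
    omega

lemma add {d₂ : ℕ} {E E' : Multiset ℕ} (h : TailClose d D D') (h₂ : TailClose d₂ E E') :
    TailClose (d + d₂) (D + E) (D' + E') := by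
  refine ⟨by simp [h.1, h₂.1], fun a => ?_⟩
  simp only [Multiset.countP_add]
  have := h.2 a
  have := h₂.2 a
  omega

/-- An interval is a difference of two upper tails, each of which moves by at most `d`. -/
lemma interval (h : TailClose d D D') {I : ℕ → Prop} [DecidablePred I] {a b : ℕ}
    (hI : ∀ x, I x ↔ (a ≤ x ∧ x < b)) : D.countP I ≤ D'.countP I + 2 * d := by
  rcases le_or_gt a b with hab | hab
  · have key : ∀ E : Multiset ℕ, E.countP (fun x => a ≤ x) =
        E.countP I + E.countP (fun x => b ≤ x) := fun E =>
      countP_split E (fun x _ => by rw [hI]; omega) (fun x _ => by rw [hI]; omega)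
    have h1 := key D
    have h2 := key D'
    have h3 := h.2 a
    have h4 := h.2 b
    omega
  · have : D.countP I = 0 := Multiset.countP_eq_zero.2 fun x _ hx => by rw [hI] at hx; omega
    omega

lemma weight (h : TailClose d D D') (k i : ℕ) : weight D k i ≤ weight D' k i + 2 * d :=
  h.interval (a := i * 2 ^ k) (b := (i + 1) * 2 ^ k) fun x => by
    rw [Nat.div_eq_iff (by positivity), Nat.add_mul, one_mul]
    have := Nat.two_pow_pos k
    omega

lemma minWeight (h : TailClose d D D') (k i : ℕ) :
    minWeight D k i ≤ minWeight D' k i + 2 * d := by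
  have h1 := h.weight k (2 * i)
  have h2 := h.weight k (2 * i + 1)
  unfold CumDP.minWeight
  omega

lemma abs_fIPP (h : TailClose d D D') (z : ℕ) : |fIPP D z - fIPP D' z| ≤ d := by
  have h1 := h.countP_le z
  have h2 := h.symm.countP_le z
  have h3 := h.2 z
  rw [fIPP, fIPP, abs_le]
  constructor
  · rw [neg_le_sub_iff_le_add]; norm_cast; omega
  · rw [sub_le_iff_le_add]; norm_cast; omega

end TailClose

/-! ### Trimming -/

lemma pairwise_sort_le (D : Multiset ℕ) (y : ℕ) :
    (D.sort (fun a b => a ≤ b)).Pairwise (fun a b => b ≤ y → a ≤ y) :=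
  (Multiset.pairwise_sort D (fun a b : ℕ => a ≤ b)).imp fun h1 h2 => h1.trans h2

lemma pairwise_sort_ge (D : Multiset ℕ) (y : ℕ) :
    (D.sort (fun a b => b ≤ a)).Pairwise (fun a b => y ≤ b → y ≤ a) :=
  (Multiset.pairwise_sort D (fun a b : ℕ => b ≤ a)).imp fun h1 h2 => h2.trans h1

/-- Cutting a sorted list after `t` entries turns a cumulative count `c` into `min t c` for the
slice and into the truncated difference `c - t` for the rest. Both maps are 1-Lipschitz, so no
distance is lost here or in the next three lemmas. -/
lemma TailClose.take_sort_le {d : ℕ} {D D' : Multiset ℕ} (h : TailClose d D D') (t : ℕ) :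
    TailClose d ↑((D.sort (fun a b => a ≤ b)).take t) ↑((D'.sort (fun a b => a ≤ b)).take t) := by
  refine of_countP_le (by simp [h.1]) fun y => ?_
  rw [countP_take_of_pairwise _ _ _ (pairwise_sort_le D y),
    countP_take_of_pairwise _ _ _ (pairwise_sort_le D' y), Multiset.sort_eq, Multiset.sort_eq]
  have := h.countP_le y
  have := h.symm.countP_le y
  omega

lemma TailClose.drop_sort_le {d : ℕ} {D D' : Multiset ℕ} (h : TailClose d D D') (t : ℕ) :
    TailClose d ↑((D.sort (fun a b => a ≤ b)).drop t) ↑((D'.sort (fun a b => a ≤ b)).drop t) := by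
  refine of_countP_le (by simp [h.1]) fun y => ?_
  rw [countP_drop_of_pairwise _ _ _ (pairwise_sort_le D y),
    countP_drop_of_pairwise _ _ _ (pairwise_sort_le D' y), Multiset.sort_eq, Multiset.sort_eq]
  have := h.countP_le y
  have := h.symm.countP_le y
  omega

lemma TailClose.take_sort_ge {d : ℕ} {D D' : Multiset ℕ} (h : TailClose d D D') (t : ℕ) :
    TailClose d ↑((D.sort (fun a b => b ≤ a)).take t) ↑((D'.sort (fun a b => b ≤ a)).take t) := by
  refine ⟨by simp [h.1], fun y => ?_⟩
  rw [countP_take_of_pairwise (fun x => y ≤ x) _ _ (pairwise_sort_ge D y),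
    countP_take_of_pairwise (fun x => y ≤ x) _ _ (pairwise_sort_ge D' y), Multiset.sort_eq, Multiset.sort_eq]
  have := h.2 y
  omega

lemma TailClose.drop_sort_ge {d : ℕ} {D D' : Multiset ℕ} (h : TailClose d D D') (t : ℕ) :
    TailClose d ↑((D.sort (fun a b => b ≤ a)).drop t) ↑((D'.sort (fun a b => b ≤ a)).drop t) := by
  refine ⟨by simp [h.1], fun y => ?_⟩
  rw [countP_drop_of_pairwise (fun x => y ≤ x) _ _ (pairwise_sort_ge D y),
    countP_drop_of_pairwise (fun x => y ≤ x) _ _ (pairwise_sort_ge D' y), Multiset.sort_eq, Multiset.sort_eq]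
  have := h.2 y
  omega

/-! ### Weights and balancedness -/

lemma div_two_pow_succ (x h : ℕ) : x / 2 ^ (h + 1) = x / 2 ^ h / 2 := by
  rw [pow_succ, Nat.div_div_eq_div_mul]

lemma weight_succ (D : Multiset ℕ) (h i : ℕ) :
    weight D (h + 1) i = weight D h (2 * i) + weight D h (2 * i + 1) :=
  countP_split D (fun x _ => by rw [div_two_pow_succ]; omega) (fun x _ => by omega)

lemma weight_succ_eq (D : Multiset ℕ) (h i : ℕ) :
    weight D (h + 1) i = weight D h (heavyChild D h i) + minWeight D h i := by
  rw [weight_succ, heavyChild, minWeight]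
  split_ifs <;> omega

lemma minWeight_le_heavyChild (D : Multiset ℕ) (h i : ℕ) :
    minWeight D h i ≤ weight D h (heavyChild D h i) := by
  rw [heavyChild, minWeight]
  split_ifs <;> omega

lemma two_mul_gammaFrom_le (D : Multiset ℕ) : ∀ h i, 2 * gammaFrom D h i ≤ weight D h i
  | 0, i => by simp [gammaFrom]
  | h + 1, i => by
    have := two_mul_gammaFrom_le D h (heavyChild D h i)
    have h1 := weight_succ_eq D h i
    have h2 := minWeight_le_heavyChild D h i
    rw [gammaFrom]
    omega

/-- When the choices differ, the heavy child of `D` is the light child of `D'`. Comparing its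
weights gives the first bound; returning from the other child of `D'` to that of `D` costs another
`2 * d`. Parting therefore happens only at nearly balanced vertices. -/
lemma heavyChild_ne {d : ℕ} {D D' : Multiset ℕ} (hD : TailClose d D D') {h i : ℕ}
    (hne : heavyChild D h i ≠ heavyChild D' h i) :
    weight D h (heavyChild D h i) ≤ minWeight D' h i + 2 * d ∧
      weight D h (heavyChild D h i) ≤ minWeight D h i + 4 * d := by
  have a1 := hD.weight h (2 * i)
  have a2 := hD.weight h (2 * i + 1)
  have a3 := hD.symm.weight h (2 * i)
  have a4 := hD.symm.weight h (2 * i + 1)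
  unfold heavyChild minWeight at *
  split_ifs at * <;> omega

/-- After a parting, the maximum over the rest of the path of `D` is at most half the weight of its
heavy child, and that weight is within `2 * d` of `minWeight D' h i`. A change of path thus does no
more harm than a change of weights. -/
lemma TailClose.gammaFrom {d : ℕ} {D D' : Multiset ℕ} (hD : TailClose d D D') :
    ∀ h i, gammaFrom D h i ≤ gammaFrom D' h i + 2 * d
  | 0, i => by simp [CumDP.gammaFrom]
  | h + 1, i => by
    have ih := hD.gammaFrom h (heavyChild D h i)
    have h1 := hD.minWeight h i
    rw [CumDP.gammaFrom, CumDP.gammaFrom]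
    by_cases hc : heavyChild D h i = heavyChild D' h i
    · rw [← hc]; omega
    · have h2 := heavyChild_ne hD hc
      have h3 := two_mul_gammaFrom_le D h (heavyChild D h i)
      omega

/-! ### Slices of the embedded data set -/

/-- The `X`-coordinates of the first `T` entries of the embedded data set. -/
def headSlice (T k : ℕ) (D : Multiset ℕ) : Multiset ℕ :=
  ↑(((embedList k D).take T).map fun p => (ofLex p).2)

/-- The `Y`-coordinates of the entries of the embedded data set after the first `T`. -/
def tailLabels (T k : ℕ) (D : Multiset ℕ) : Multiset ℕ :=
  ↑(((embedList k D).drop T).map fun p => (ofLex p).1)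

lemma mem_embedList {k : ℕ} {D : Multiset ℕ} {p : ℕ ×ₗ ℕ} (hp : p ∈ embedList k D) :
    ∃ x ∈ D, p = toLex (labelFrom D x k 0 0, x) := by
  rw [embedList, Multiset.mem_sort, Multiset.mem_map] at hp
  obtain ⟨x, hx, rfl⟩ := hp
  exact ⟨x, hx, rfl⟩

lemma countP_embedList (k : ℕ) (D : Multiset ℕ) (U : ℕ → Prop) [DecidablePred U] :
    Multiset.countP (fun p : ℕ ×ₗ ℕ => U (ofLex p).2) ↑(embedList k D) = D.countP U := by
  rw [embedList, Multiset.sort_eq, Multiset.countP_map, Multiset.countP_eq_card_filter]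
  rfl

/-- `U` is closed upwards in the order of the embedded data set. -/
def IsUpper (k : ℕ) (D : Multiset ℕ) (U : ℕ → Prop) : Prop :=
  ∀ x ∈ D, ∀ y ∈ D, (labelFrom D x k 0 0 < labelFrom D y k 0 0 ∨
    (labelFrom D x k 0 0 = labelFrom D y k 0 0 ∧ x ≤ y)) → U x → U y

lemma IsUpper.pairwise {k : ℕ} {D : Multiset ℕ} {U : ℕ → Prop} (hU : IsUpper k D U) :
    (embedList k D).Pairwise fun a b => U (ofLex b).2 → U (ofLex a).2 := by
  refine List.Pairwise.imp_of_mem ?_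
    (Multiset.pairwise_sort (D.map fun x => toLex (labelFrom D x k 0 0, x)) (fun a b => b ≤ a))
  intro a b ha hb hab
  obtain ⟨x, hx, rfl⟩ := mem_embedList ha
  obtain ⟨y, hy, rfl⟩ := mem_embedList hb
  exact hU y hy x hx (Prod.Lex.toLex_le_toLex.1 hab)

lemma countP_headSlice_eq (T k : ℕ) (D : Multiset ℕ) (P : ℕ → Prop) [DecidablePred P] :
    (headSlice T k D).countP P =
      Multiset.countP (fun p : ℕ ×ₗ ℕ => P (ofLex p).2) ↑((embedList k D).take T) := by
  rw [headSlice, ← Multiset.map_coe, Multiset.countP_map, Multiset.countP_eq_card_filter]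

lemma IsUpper.countP_headSlice {k : ℕ} {D : Multiset ℕ} {U : ℕ → Prop} [DecidablePred U]
    (hU : IsUpper k D U) (T : ℕ) : (headSlice T k D).countP U = min T (D.countP U) := by
  rw [countP_headSlice_eq, countP_take_of_pairwise _ _ _ hU.pairwise, countP_embedList]

/-- An upper set with at most `T` points lies entirely in the slice, so nothing of it is left in the
dropped part. -/
lemma IsUpper.countP_headSlice_and {k : ℕ} {D : Multiset ℕ} {U : ℕ → Prop} [DecidablePred U]
    (hU : IsUpper k D U) {T : ℕ} (hT : D.countP U ≤ T) (P : ℕ → Prop) [DecidablePred P] :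
    (headSlice T k D).countP (fun x => P x ∧ U x) = D.countP (fun x => P x ∧ U x) := by
  have h1 := countP_drop_of_pairwise _ _ T hU.pairwise
  rw [countP_embedList, Nat.sub_eq_zero_of_le hT] at h1
  have h2 := countP_take_add_drop (fun p : ℕ ×ₗ ℕ => P (ofLex p).2 ∧ U (ofLex p).2)
    (embedList k D) T
  have h3 : Multiset.countP (fun p : ℕ ×ₗ ℕ => P (ofLex p).2 ∧ U (ofLex p).2)
      ↑((embedList k D).drop T) ≤ 0 := h1 ▸ countP_le_of_imp _ fun p _ hp => hp.2
  rw [countP_embedList k D (fun x => P x ∧ U x)] at h2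
  rw [countP_headSlice_eq]
  omega

lemma countP_tailLabels (T k : ℕ) (D : Multiset ℕ) (q : ℕ) :
    (tailLabels T k D).countP (fun y => q ≤ y) =
      D.countP (fun x => q ≤ labelFrom D x k 0 0) - T := by
  have hU : IsUpper k D (fun x => q ≤ labelFrom D x k 0 0) := fun x _ y _ h hx => by
    simp only at *; omega
  rw [← countP_embedList k D, ← countP_drop_of_pairwise _ _ T hU.pairwise, tailLabels,
    ← Multiset.map_coe, Multiset.countP_map, ← Multiset.countP_eq_card_filter]
  refine countP_congr_mem _ fun p hp => ?_
  obtain ⟨x, hx, rfl⟩ := mem_embedList (List.mem_of_mem_drop hp)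
  rfl

lemma card_headSlice (T k : ℕ) (D : Multiset ℕ) : (headSlice T k D).card = min T D.card := by
  simp [headSlice, embedList]

lemma card_tailLabels (T k : ℕ) (D : Multiset ℕ) : (tailLabels T k D).card = D.card - T := by
  simp [tailLabels, embedList]

lemma mem_of_mem_headSlice {T k : ℕ} {D : Multiset ℕ} {x : ℕ} (hx : x ∈ headSlice T k D) :
    x ∈ D := by
  rw [headSlice, Multiset.mem_coe, List.mem_map] at hx
  obtain ⟨p, hp, rfl⟩ := hx
  obtain ⟨y, hy, rfl⟩ := mem_embedList (List.mem_of_mem_take hp)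
  exact hy

/-! ### Labels and the heavy path -/

lemma labelFrom_bounds (D : Multiset ℕ) (x : ℕ) : ∀ h i q,
    q ≤ labelFrom D x (h + 1) i q ∧ labelFrom D x (h + 1) i q ≤ q + h
  | 0, i, q => by rw [labelFrom]; split_ifs <;> simp [labelFrom]
  | h + 1, i, q => by
    have := labelFrom_bounds D x h (heavyChild D (h + 1) i) (q + 1)
    rw [labelFrom]; split_ifs <;> omega

lemma lt_of_mem_tailLabels {T k : ℕ} {D : Multiset ℕ} (hk : 0 < k) {x : ℕ}
    (hx : x ∈ tailLabels T k D) : x < k := by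
  rw [tailLabels, Multiset.mem_coe, List.mem_map] at hx
  obtain ⟨p, hp, rfl⟩ := hx
  obtain ⟨y, hy, rfl⟩ := mem_embedList (List.mem_of_mem_drop hp)
  obtain ⟨k, rfl⟩ := Nat.exists_eq_add_of_lt hk
  have := labelFrom_bounds D y (0 + k) 0 0
  simp only [ofLex_toLex]
  omega

/-- The index of the vertex number `j` (the root has number `0`) of the heavy path in the tree of
height `k`. -/
def heavyPath (D : Multiset ℕ) (k : ℕ) : ℕ → ℕ
  | 0 => 0
  | j + 1 => heavyChild D (k - (j + 1)) (heavyPath D k j)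

lemma heavyChild_div_two (D : Multiset ℕ) (h i : ℕ) : heavyChild D h i / 2 = i := by
  rw [heavyChild]; split_ifs <;> omega

lemma heavyPath_below_pred {D : Multiset ℕ} {k j x : ℕ} (hj : j < k)
    (h : x / 2 ^ (k - (j + 1)) = heavyPath D k (j + 1)) : x / 2 ^ (k - j) = heavyPath D k j := by
  rw [show k - j = k - (j + 1) + 1 by omega, div_two_pow_succ, h, heavyPath, heavyChild_div_two]

lemma heavyPath_below_mono {D : Multiset ℕ} {k i j x : ℕ} (hij : i ≤ j) (hj : j ≤ k)
    (h : x / 2 ^ (k - j) = heavyPath D k j) : x / 2 ^ (k - i) = heavyPath D k i := by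
  induction j, hij using Nat.le_induction with
  | base => exact h
  | succ j _ ih => exact ih (by omega) (heavyPath_below_pred (by omega) h)

lemma le_labelFrom_iff_aux {D : Multiset ℕ} {k x j : ℕ} (hj : j < k) : ∀ h q, q + h = k → q ≤ j →
    x / 2 ^ h = heavyPath D k q →
    (j ≤ labelFrom D x h (heavyPath D k q) q ↔ x / 2 ^ (k - j) = heavyPath D k j)
  | 0, q, hq, hqj, _ => by omega
  | h + 1, q, hq, hqj, hx => by
    rcases hqj.eq_or_lt with rfl | hlt
    · have := (labelFrom_bounds D x h (heavyPath D k q) q).1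
      rw [show k - q = h + 1 by omega]
      simp [hx, this]
    · have hh : k - (q + 1) = h := by omega
      have hs : heavyPath D k (q + 1) = heavyChild D h (heavyPath D k q) := by
        rw [heavyPath, hh]
      rw [labelFrom, ← hs]
      split_ifs with hc
      · exact le_labelFrom_iff_aux hj h (q + 1) (by omega) hlt hc
      · constructor
        · intro h1; omega
        · intro h1
          exact absurd (hh ▸ heavyPath_below_mono hlt hj.le h1) hc

/-- Upper tails of the labels thereby become subtree weights, whose sensitivity is known. The
condition `j < k` excludes the final leaf, which has no label of its own. -/
lemma le_labelFrom_iff {D : Multiset ℕ} {k x j : ℕ} (hj : j < k) (hx : x < 2 ^ k) :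
    j ≤ labelFrom D x k 0 0 ↔ x / 2 ^ (k - j) = heavyPath D k j :=
  le_labelFrom_iff_aux hj k 0 (by omega) (by omega) (Nat.div_eq_of_lt hx)

lemma countP_le_labelFrom {D : Multiset ℕ} {k j : ℕ} (hj : j < k) (hD : ∀ x ∈ D, x < 2 ^ k) :
    D.countP (fun x => j ≤ labelFrom D x k 0 0) = weight D (k - j) (heavyPath D k j) :=
  countP_congr_mem D fun x hx => le_labelFrom_iff hj (hD x hx)

lemma minWeight_heavyPath_le (D : Multiset ℕ) (k j : ℕ) (hj : j < k) :
    minWeight D (k - (j + 1)) (heavyPath D k j) ≤ Gam k D := by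
  have key : ∀ j, j ≤ k → gammaFrom D (k - j) (heavyPath D k j) ≤ gammaFrom D k 0 := by
    intro j
    induction j with
    | zero => intro _; exact le_rfl
    | succ j ih =>
      intro hj
      refine le_trans ?_ (ih (by omega))
      rw [show k - j = k - (j + 1) + 1 by omega, gammaFrom, heavyPath]
      exact le_max_right _ _
  refine le_trans ?_ (key j hj.le)
  rw [show k - j = k - (j + 1) + 1 by omega, gammaFrom]
  exact le_max_left _ _

lemma exists_common_prefix (f g : ℕ → ℕ) (h0 : f 0 = g 0) (m : ℕ) :
    ∃ J ≤ m, (∀ i ≤ J, f i = g i) ∧ (J = m ∨ f (J + 1) ≠ g (J + 1)) := by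
  induction m with
  | zero => exact ⟨0, le_rfl, fun i hi => by rw [Nat.le_zero.1 hi, h0], Or.inl rfl⟩
  | succ m ih =>
    obtain ⟨J, hJ, h1, h2⟩ := ih
    rcases h2 with rfl | h2
    · by_cases h : f (J + 1) = g (J + 1)
      · exact ⟨J + 1, le_rfl, fun i hi => by
          rcases Nat.le_succ_iff.1 hi with hi | rfl
          · exact h1 i hi
          · exact h, Or.inl rfl⟩
      · exact ⟨J, by omega, h1, Or.inr h⟩
    · exact ⟨J, by omega, h1, Or.inr h2⟩

/-- The vertex number `J` is the last common vertex of the heavy paths, unless `J = k - 1`; the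
points below it are among the first `T` in this case. -/
structure CommonPath (k T J : ℕ) (D D' : Multiset ℕ) : Prop where
  lt : J < k
  eq : ∀ i ≤ J, heavyPath D k i = heavyPath D' k i
  left : J + 1 = k ∨ weight D (k - J) (heavyPath D k J) ≤ T
  right : J + 1 = k ∨ weight D' (k - J) (heavyPath D' k J) ≤ T

lemma CommonPath.symm {k T J : ℕ} {D D' : Multiset ℕ} (h : CommonPath k T J D D') :
    CommonPath k T J D' D :=
  ⟨h.lt, fun i hi => (h.eq i hi).symm, h.right, h.left⟩

lemma exists_commonPath {d k T : ℕ} {D D' : Multiset ℕ} (hk : 0 < k) (hD : TailClose d D D')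
    (hT : 2 * Gam k D + 6 * d ≤ T) : ∃ J, CommonPath k T J D D' := by
  obtain ⟨J, hJ, h1, h2⟩ := exists_common_prefix (heavyPath D k) (heavyPath D' k) rfl (k - 1)
  have key : J + 1 = k ∨ weight D (k - J) (heavyPath D k J) + 2 * d ≤ T := by
    rcases h2 with rfl | h2
    · exact Or.inl (by omega)
    · rcases Nat.lt_or_ge (J + 1) k with hlt | hge
      swap
      · exact Or.inl (by omega)
      right
      rw [heavyPath, heavyPath, ← h1 J le_rfl] at h2
      have h3 := (heavyChild_ne hD h2).2
      have h4 := minWeight_heavyPath_le D k J (by omega)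
      -- Heavy child plus light child is at most `2 Γ + 4 * d`; the remaining `2 * d` in the
      -- hypothesis pays for the passage to `D'`.
      rw [show k - J = k - (J + 1) + 1 by omega, weight_succ_eq]
      omega
  refine ⟨J, by omega, h1, by omega, ?_⟩
  have := hD.symm.weight (k - J) (heavyPath D k J)
  rw [← h1 J le_rfl]
  omega

/-- For `q ≤ J` the tail is the weight of a common vertex, minus `T`. For `q > J` it is empty on
both sides: either no label exceeds `J = k - 1`, or all points below vertex `J` have been cut off.
-/
lemma TailClose.tailLabels {d k T : ℕ} {D D' : Multiset ℕ} (hD : TailClose d D D') {J : ℕ}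
    (hJ : CommonPath k T J D D') (h1 : ∀ x ∈ D, x < 2 ^ k) (h2 : ∀ x ∈ D', x < 2 ^ k) :
    TailClose (2 * d) (tailLabels T k D) (tailLabels T k D') := by
  refine ⟨by rw [card_tailLabels, card_tailLabels, hD.1], fun q => ?_⟩
  rw [countP_tailLabels, countP_tailLabels]
  rcases le_or_gt q J with hq | hq
  · have hqk := hq.trans_lt hJ.lt
    rw [countP_le_labelFrom hqk h1, countP_le_labelFrom hqk h2, hJ.eq q hq]
    have := hD.weight (k - q) (heavyPath D' k q)
    have := hD.symm.weight (k - q) (heavyPath D' k q)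
    omega
  · have key : ∀ E : Multiset ℕ, (∀ x ∈ E, x < 2 ^ k) →
        (J + 1 = k ∨ CumDP.weight E (k - J) (heavyPath E k J) ≤ T) →
        E.countP (fun x => q ≤ labelFrom E x k 0 0) ≤ T := by
      rintro E hE (h | h)
      · subst h
        have : E.countP (fun x => q ≤ labelFrom E x (J + 1) 0 0) = 0 :=
          Multiset.countP_eq_zero.2 fun x _ hx => by
            have := (labelFrom_bounds E x J 0 0).2
            omega
        omega
      · rw [← countP_le_labelFrom hJ.lt hE] at h
        exact (countP_le_of_imp E fun x _ hx => hq.le.trans hx).trans h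
    have := key D h1 hJ.left
    have := key D' h2 hJ.right
    omega

/-! ### Sensitivity of the slice `headSlice` -/

/-- `S` and `S'` are the `T` points of largest key. At the key `θ` where the slices fill up, `S` has
at most `s` points of smaller key. The points of key `θ` are copies of a single element, so `I`
contains all or none of them, and their number changes by at most `2 * s`. Above `θ` the slices
coincide with `D` and `D'`, which adds `s`. -/
lemma countP_le_of_top_slices {I : ℕ → Prop} [DecidablePred I] (κ : ℕ → ℕ) {T s : ℕ} (hT : 0 < T)
    {D D' S S' : Multiset ℕ}
    (hD : ∀ θ, D.countP (fun x => θ ≤ κ x) ≤ D'.countP (fun x => θ ≤ κ x) + s ∧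
      D'.countP (fun x => θ ≤ κ x) ≤ D.countP (fun x => θ ≤ κ x) + s)
    (hI : ∀ θ, D.countP (fun x => I x ∧ θ ≤ κ x) ≤ D'.countP (fun x => I x ∧ θ ≤ κ x) + s)
    (hS : ∀ θ, S.countP (fun x => θ ≤ κ x) = min T (D.countP fun x => θ ≤ κ x))
    (hS' : ∀ θ, S'.countP (fun x => θ ≤ κ x) = min T (D'.countP fun x => θ ≤ κ x))
    (hSI : ∀ θ, D.countP (fun x => θ ≤ κ x) ≤ T →
      S.countP (fun x => I x ∧ θ ≤ κ x) = D.countP (fun x => I x ∧ θ ≤ κ x))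
    (hSI' : ∀ θ, D'.countP (fun x => θ ≤ κ x) ≤ T →
      S'.countP (fun x => I x ∧ θ ≤ κ x) = D'.countP (fun x => I x ∧ θ ≤ κ x))
    (hinj : ∀ x ∈ S + S', ∀ y ∈ S + S', κ x = κ y → x = y) :
    S.countP I ≤ S'.countP I + 4 * s := by
  have h00 : ∀ E : Multiset ℕ, E.countP I = E.countP (fun x => I x ∧ 0 ≤ κ x) := fun E => by simp
  by_cases h0 : D.countP (fun x => 0 ≤ κ x) < T ∧ D'.countP (fun x => 0 ≤ κ x) < T
  · rw [h00 S, h00 S', hSI 0 h0.1.le, hSI' 0 h0.2.le]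
    have := hI 0
    omega
  have hex : ∃ θ, D.countP (fun x => θ ≤ κ x) < T ∧ D'.countP (fun x => θ ≤ κ x) < T := by
    obtain ⟨B, hB⟩ : ∃ B, ∀ x ∈ D + D', κ x < B :=
      ⟨((D + D').map κ).sup + 1, fun x hx =>
        Nat.lt_succ_of_le (Multiset.le_sup (Multiset.mem_map_of_mem κ hx))⟩
    have key : ∀ E ≤ D + D', E.countP (fun x => B ≤ κ x) = 0 := fun E hE =>
      Multiset.countP_eq_zero.2 fun x hx h => (hB x (Multiset.mem_of_le hE hx)).not_ge h
    exact ⟨B, by rw [key D (Multiset.le_add_right _ _)]; exact hT,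
      by rw [key D' (Multiset.le_add_left _ _)]; exact hT⟩
  classical
  -- Above `θ` both data sets have fewer than `T` points, but from `θ` on at least one has `T`; the
  -- other then has at least `T - s`.
  obtain ⟨θ, hθ⟩ : ∃ θ, Nat.find hex = θ + 1 :=
    Nat.exists_eq_succ_of_ne_zero fun h => h0 (h ▸ Nat.find_spec hex)
  obtain ⟨u1, u2⟩ := hθ ▸ Nat.find_spec hex
  have u3 := Nat.find_min hex (m := θ) (by omega)
  have split1 : ∀ E : Multiset ℕ, E.countP I = E.countP (fun x => I x ∧ κ x < θ) +
      (E.countP (fun x => I x ∧ κ x = θ) + E.countP (fun x => I x ∧ θ + 1 ≤ κ x)) := fun E => by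
    rw [← countP_split E (p := fun x => I x ∧ θ ≤ κ x)
      (fun x _ => by rw [← and_or_left]; exact and_congr_right fun _ => by omega)
      (fun x _ => by omega)]
    exact countP_split E
      (fun x _ => by rw [← and_or_left]; exact ⟨fun h => ⟨h, by omega⟩, fun h => h.1⟩)
      (fun x _ => by omega)
  have split2 : ∀ E : Multiset ℕ, E.countP (fun x => θ ≤ κ x) = E.countP (fun x => κ x = θ) +
      E.countP (fun x => θ + 1 ≤ κ x) := fun E =>
    countP_split E (fun x _ => by omega) (fun x _ => by omega)
  have split3 : ∀ E : Multiset ℕ, E.countP (fun x => 0 ≤ κ x) = E.countP (fun x => κ x < θ) +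
      E.countP (fun x => θ ≤ κ x) := fun E =>
    countP_split E (fun x _ => by omega) (fun x _ => by omega)
  have e1 : S.countP (fun x => I x ∧ κ x < θ) ≤ S.countP (fun x => κ x < θ) :=
    countP_le_of_imp S fun x _ hx => hx.2
  have e2 : S.countP (fun x => I x ∧ κ x = θ) ≤ S'.countP (fun x => I x ∧ κ x = θ) + 2 * s := by
    by_cases hp : ∃ x ∈ S + S', I x ∧ κ x = θ
    · obtain ⟨x, hx, hIx, hκx⟩ := hp
      have key : ∀ E ≤ S + S', E.countP (fun x => I x ∧ κ x = θ) =
          E.countP (fun x => κ x = θ) := fun E hE =>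
        countP_congr_mem E fun y hy => ⟨fun h => h.2, fun h =>
          ⟨hinj x hx y (Multiset.mem_of_le hE hy) (hκx.trans h.symm) ▸ hIx, h⟩⟩
      rw [key S (Multiset.le_add_right _ _), key S' (Multiset.le_add_left _ _)]
      have a1 := split2 S
      have a2 := split2 S'
      have a3 := hS θ
      have a4 := hS' θ
      have a5 := hS (θ + 1)
      have a6 := hS' (θ + 1)
      have a7 := hD θ
      have a8 := hD (θ + 1)
      omega
    · have : S.countP (fun x => I x ∧ κ x = θ) = 0 :=
        Multiset.countP_eq_zero.2 fun x hx h => hp ⟨x, Multiset.mem_add.2 (Or.inl hx), h⟩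
      omega
  have b1 := split1 S
  have b2 := split1 S'
  have b3 := split3 S
  have b4 := hSI (θ + 1) u1.le
  have b5 := hSI' (θ + 1) u2.le
  have b6 := hI (θ + 1)
  have b7 := hS 0
  have b8 := hS θ
  have b9 := hD θ
  omega

/-- The position of `x` in the order of the embedded data set when the labels `≥ J` are
identified. -/
def truncKey (J k : ℕ) (D : Multiset ℕ) (x : ℕ) : ℕ := min (labelFrom D x k 0 0) J * 2 ^ k + x

/-- The number `l * M + x` encodes the pair `(l, x)` in lexicographic order. -/
lemma le_mul_add_iff {M θ l x : ℕ} (hx : x < M) :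
    θ ≤ l * M + x ↔ θ / M < l ∨ (θ / M = l ∧ θ % M ≤ x) := by
  have hM : 0 < M := by omega
  have h1 := Nat.div_add_mod θ M
  have h2 := Nat.mod_lt θ hM
  rcases lt_trichotomy (θ / M) l with h | h | h
  · have : M * (θ / M + 1) ≤ M * l := Nat.mul_le_mul_left _ h
    rw [Nat.mul_add, mul_one] at this
    rw [mul_comm l M]
    constructor
    · intro _; exact Or.inl h
    · intro _; omega
  · subst h
    rw [mul_comm (θ / M) M]
    omega
  · have : M * (l + 1) ≤ M * (θ / M) := Nat.mul_le_mul_left _ h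
    rw [Nat.mul_add, mul_one] at this
    rw [mul_comm l M]
    constructor
    · intro _; omega
    · intro _; omega

lemma truncKey_injective {J k : ℕ} {D : Multiset ℕ} {x y : ℕ} (hx : x < 2 ^ k) (hy : y < 2 ^ k)
    (h : truncKey J k D x = truncKey J k D y) : x = y := by
  have := congrArg (· % 2 ^ k) h
  simpa [truncKey, Nat.mod_eq_of_lt hx, Nat.mod_eq_of_lt hy] using this

lemma le_truncKey_iff {J k θ : ℕ} {D : Multiset ℕ} {x : ℕ} (hx : x < 2 ^ k) :
    θ ≤ truncKey J k D x ↔ θ / 2 ^ k < min (labelFrom D x k 0 0) J ∨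
      (θ / 2 ^ k = min (labelFrom D x k 0 0) J ∧ θ % 2 ^ k ≤ x) :=
  le_mul_add_iff hx

lemma div_two_pow_eq_iff (x h n : ℕ) : x / 2 ^ h = n ↔ n * 2 ^ h ≤ x ∧ x < (n + 1) * 2 ^ h := by
  rw [Nat.div_eq_iff (by positivity), Nat.add_mul, one_mul]
  have := Nat.two_pow_pos h
  omega

/-- A label capped at `J` depends only on the path vertices up to `J`, which are common. -/
lemma CommonPath.truncKey_eq {k T J : ℕ} {D D' : Multiset ℕ} (hJ : CommonPath k T J D D') {x : ℕ}
    (hx : x < 2 ^ k) : truncKey J k D x = truncKey J k D' x := by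
  have key : ∀ j ≤ J, (j ≤ labelFrom D x k 0 0 ↔ j ≤ labelFrom D' x k 0 0) := fun j hj => by
    have hjk := hj.trans_lt hJ.lt
    rw [le_labelFrom_iff hjk hx, le_labelFrom_iff hjk hx, hJ.eq j hj]
  have h1 := key (min (labelFrom D x k 0 0) J) (min_le_right _ _)
  have h2 := key (min (labelFrom D' x k 0 0) J) (min_le_right _ _)
  have : min (labelFrom D x k 0 0) J = min (labelFrom D' x k 0 0) J := by omega
  rw [truncKey, truncKey, this]

/-- With `θ` encoding `(q, r)` and `q < J`, labels above `q` mean the subtree of path vertex `q +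
1`, and label `q` means the subtree of its sibling, cut to `x ≥ r`. For `q = J` a single interval
remains, and for `q > J` none. -/
lemma exists_intervals {J k : ℕ} (hJ : J < k) (D : Multiset ℕ) (θ : ℕ) :
    ∃ a b a' b' : ℕ, ∀ x < 2 ^ k, (θ ≤ truncKey J k D x ↔ (a ≤ x ∧ x < b) ∨ (a' ≤ x ∧ x < b')) ∧
      ¬ ((a ≤ x ∧ x < b) ∧ (a' ≤ x ∧ x < b')) := by
  set q := θ / 2 ^ k with hq
  rcases lt_trichotomy q J with h | h | h
  · set c := heavyPath D k (q + 1) with hc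
    set s := k - (q + 1) with hs
    -- The sibling of `c`: the two children of `c / 2` have indices with sum `4 * (c / 2) + 1`.
    set c' := 4 * (c / 2) + 1 - c with hc'
    refine ⟨c * 2 ^ s, (c + 1) * 2 ^ s, max (c' * 2 ^ s) (θ % 2 ^ k), (c' + 1) * 2 ^ s,
      fun x hx => ?_⟩
    have e1 := le_labelFrom_iff (D := D) (show q + 1 < k by omega) hx
    have e2 := le_labelFrom_iff (D := D) (show q < k by omega) hx
    have e3 : heavyPath D k q = c / 2 := by rw [hc, heavyPath, heavyChild_div_two]
    rw [e3, show k - q = s + 1 by omega, div_two_pow_succ] at e2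
    rw [← hc, ← hs] at e1
    rw [le_truncKey_iff hx, max_le_iff, and_right_comm, ← div_two_pow_eq_iff,
      ← div_two_pow_eq_iff, ← hq]
    omega
  · refine ⟨max (heavyPath D k J * 2 ^ (k - J)) (θ % 2 ^ k), (heavyPath D k J + 1) * 2 ^ (k - J),
      0, 0, fun x hx => ?_⟩
    have e1 := le_labelFrom_iff (D := D) hJ hx
    rw [le_truncKey_iff hx, max_le_iff, and_right_comm, ← div_two_pow_eq_iff, ← hq]
    omega
  · refine ⟨0, 0, 0, 0, fun x hx => ?_⟩
    rw [le_truncKey_iff hx]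
    omega

lemma countP_truncKey_le {d J k : ℕ} (hJ : J < k) {D D' : Multiset ℕ} (hD : TailClose d D D')
    (h1 : ∀ x ∈ D, x < 2 ^ k) (h2 : ∀ x ∈ D', x < 2 ^ k) {I : ℕ → Prop} [DecidablePred I]
    {u v : ℕ} (hI : ∀ x, I x ↔ (u ≤ x ∧ x < v)) (E : Multiset ℕ) (θ : ℕ) :
    D.countP (fun x => I x ∧ θ ≤ truncKey J k E x) ≤
      D'.countP (fun x => I x ∧ θ ≤ truncKey J k E x) + 4 * d := by
  obtain ⟨a, b, a', b', h⟩ := exists_intervals hJ E θ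
  have key : ∀ F : Multiset ℕ, (∀ x ∈ F, x < 2 ^ k) →
      F.countP (fun x => I x ∧ θ ≤ truncKey J k E x) =
      F.countP (fun x => max u a ≤ x ∧ x < min v b) +
        F.countP (fun x => max u a' ≤ x ∧ x < min v b') := fun F hF =>
    countP_split F (fun x hx => by rw [hI, (h x (hF x hx)).1]; omega)
      (fun x hx => by have := (h x (hF x hx)).2; omega)
  rw [key D h1, key D' h2]
  have e1 := hD.interval (I := fun x => max u a ≤ x ∧ x < min v b) (fun x => Iff.rfl)
  have e2 := hD.interval (I := fun x => max u a' ≤ x ∧ x < min v b') (fun x => Iff.rfl)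
  omega

/-- The merged order differs from the embedding order only among labels `≥ J`, and not at all if `J
+ 1 = k`. An upper set that cuts into these labels consists of points below vertex `J`, and all of
those are in the slice. -/
lemma countP_headSlice_truncKey {k T J : ℕ} {D : Multiset ℕ} (hJk : J < k)
    (hD : ∀ x ∈ D, x < 2 ^ k) (hJ : J + 1 = k ∨ weight D (k - J) (heavyPath D k J) ≤ T) (θ : ℕ) :
    (headSlice T k D).countP (fun x => θ ≤ truncKey J k D x) =
        min T (D.countP fun x => θ ≤ truncKey J k D x) ∧
      ∀ (I : ℕ → Prop) [DecidablePred I], D.countP (fun x => θ ≤ truncKey J k D x) ≤ T →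
        (headSlice T k D).countP (fun x => I x ∧ θ ≤ truncKey J k D x) =
          D.countP (fun x => I x ∧ θ ≤ truncKey J k D x) := by
  by_cases hc : J + 1 = k ∨ θ / 2 ^ k < J
  · have hU : IsUpper k D (fun x => θ ≤ truncKey J k D x) := by
      intro x hx y hy hxy
      simp only [le_truncKey_iff (hD x hx), le_truncKey_iff (hD y hy)]
      obtain ⟨k, rfl⟩ : ∃ m, k = m + 1 := ⟨k - 1, by omega⟩
      have := labelFrom_bounds D x k 0 0
      have := labelFrom_bounds D y k 0 0
      omega
    exact ⟨hU.countP_headSlice T, fun I _ hT => hU.countP_headSlice_and hT I⟩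
  · have hw : D.countP (fun x => J ≤ labelFrom D x k 0 0) ≤ T := by
      rw [countP_le_labelFrom hJk hD]; tauto
    have hV : IsUpper k D (fun x => J ≤ labelFrom D x k 0 0) := fun x _ y _ h hx => by
      simp only at *; omega
    have hUV : ∀ x ∈ D, θ ≤ truncKey J k D x → J ≤ labelFrom D x k 0 0 := fun x hx h => by
      rw [le_truncKey_iff (hD x hx)] at h
      omega
    have key : ∀ (P : ℕ → Prop) [DecidablePred P], (∀ x ∈ D, P x → J ≤ labelFrom D x k 0 0) →
        (headSlice T k D).countP P = D.countP P := fun P _ hP => by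
      rw [countP_congr_mem D fun x hx => (and_iff_left_of_imp (hP x hx)).symm,
        ← hV.countP_headSlice_and hw P]
      exact countP_congr_mem _ fun x hx =>
        (and_iff_left_of_imp (hP x (mem_of_mem_headSlice hx))).symm
    refine ⟨?_, fun I _ _ => key _ fun x hx h => hUV x hx h.2⟩
    rw [key _ hUV, min_eq_right ((countP_le_of_imp D hUV).trans hw)]

/-- An upper set of the common order is two intervals, so counts in it change by at most `s = 4 *
d`; `countP_le_of_top_slices` multiplies this by `4`. -/
lemma TailClose.weight_headSlice {d k T J : ℕ} (hT : 0 < T) {D D' : Multiset ℕ}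
    (hD : TailClose d D D') (hJ : CommonPath k T J D D') (h1 : ∀ x ∈ D, x < 2 ^ k)
    (h2 : ∀ x ∈ D', x < 2 ^ k) (h i : ℕ) :
    CumDP.weight (headSlice T k D) h i ≤ CumDP.weight (headSlice T k D') h i + 16 * d := by
  have hκ : ∀ x, x < 2 ^ k → truncKey J k D' x = truncKey J k D x := fun x hx =>
    (hJ.truncKey_eq hx).symm
  have hS := countP_headSlice_truncKey hJ.lt h1 hJ.left
  have hS' := countP_headSlice_truncKey hJ.lt h2 hJ.right
  have m1 : ∀ x ∈ headSlice T k D, x < 2 ^ k := fun x hx => h1 x (mem_of_mem_headSlice hx)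
  have m2 : ∀ x ∈ headSlice T k D', x < 2 ^ k := fun x hx => h2 x (mem_of_mem_headSlice hx)
  have tr : ∀ (E : Multiset ℕ), (∀ x ∈ E, x < 2 ^ k) → ∀ θ,
      E.countP (fun x => θ ≤ truncKey J k D' x) = E.countP (fun x => θ ≤ truncKey J k D x) :=
    fun E hE θ => countP_congr_mem E fun x hx => by rw [hκ x (hE x hx)]
  have trI : ∀ (E : Multiset ℕ), (∀ x ∈ E, x < 2 ^ k) → ∀ θ,
      E.countP (fun x => x / 2 ^ h = i ∧ θ ≤ truncKey J k D' x) =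
        E.countP (fun x => x / 2 ^ h = i ∧ θ ≤ truncKey J k D x) :=
    fun E hE θ => countP_congr_mem E fun x hx => by rw [hκ x (hE x hx)]
  have all : ∀ E : Multiset ℕ, (∀ x ∈ E, x < 2 ^ k) → ∀ θ,
      E.countP (fun x => θ ≤ truncKey J k D x) =
        E.countP (fun x => (0 ≤ x ∧ x < 2 ^ k) ∧ θ ≤ truncKey J k D x) := fun E hE θ =>
    countP_congr_mem E fun x hx => by simp [hE x hx]
  have h16 : 16 * d = 4 * (4 * d) := by ring
  rw [h16]
  refine countP_le_of_top_slices (D := D) (D' := D') (truncKey J k D) hT (fun θ => ?_) (fun θ => ?_)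
    (fun θ => (hS θ).1) (fun θ => ?_) (fun θ => (hS θ).2 _) (fun θ hθ => ?_) (fun x hx y hy => ?_)
  · rw [all D h1, all D' h2]
    exact ⟨countP_truncKey_le hJ.lt hD h1 h2 (fun x => Iff.rfl) D θ,
      countP_truncKey_le hJ.lt hD.symm h2 h1 (fun x => Iff.rfl) D θ⟩
  · exact countP_truncKey_le hJ.lt hD h1 h2 (fun x => div_two_pow_eq_iff x h i) D θ
  · rw [← tr _ m2, ← tr _ h2]
    exact (hS' θ).1
  · rw [← trI _ m2, ← trI _ h2]
    rw [← tr _ h2] at hθ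
    exact (hS' θ).2 _ hθ
  · have key : ∀ z ∈ headSlice T k D + headSlice T k D', z < 2 ^ k := fun z hz =>
      (Multiset.mem_add.1 hz).elim (m1 z) (m2 z)
    exact truncKey_injective (key x hx) (key y hy)

lemma sum_weight_le (S : Multiset ℕ) (h m : ℕ) :
    ∑ i ∈ Finset.range m, weight S h i ≤ S.card := by
  induction S using Multiset.induction_on with
  | empty => simp [weight]
  | cons a S ih =>
    simp only [weight, Multiset.countP_cons, Finset.sum_add_distrib, Multiset.card_cons] at ih ⊢
    gcongr
    rw [Finset.sum_ite_eq]
    split_ifs <;> omega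

/-! ### `OneHeavyRound` -/

/-- In this and the following inequalities `p`, `q` stand for the probabilities of two branches and
`x`, `y` for the expected test values after them; primes mark the second data set. -/
lemma mix_le {c p x q y p' x' q' y' e₁ e₂ : ℝ≥0∞} (h1 : p * x ≤ c * (p' * x') + e₁)
    (h2 : q * y ≤ c * (q' * y') + e₂) :
    p * x + q * y ≤ c * (p' * x' + q' * y') + (e₁ + e₂) := by
  calc p * x + q * y ≤ (c * (p' * x') + e₁) + (c * (q' * y') + e₂) := add_le_add h1 h2
    _ = _ := by ring

lemma mul_le_of_factor {c p p' x : ℝ≥0∞} (h : p ≤ c * p') : p * x ≤ c * (p' * x) + 0 := by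
  rw [add_zero, ← mul_assoc]; gcongr

lemma mul_le_of_small {c p x x' e : ℝ≥0∞} (h : p ≤ e) (hx : x ≤ 1) : p * x ≤ c * x' + e :=
  calc p * x ≤ e * 1 := mul_le_mul' h hx
    _ ≤ _ := by rw [mul_one]; exact le_add_self

lemma mul_le_of_close {c c' p p' x x' e : ℝ≥0∞} (h : p ≤ c * p') (hp : p ≤ 1)
    (hx : x ≤ c' * x' + e) : p * x ≤ c * c' * (p' * x') + e :=
  calc p * x ≤ p * (c' * x') + p * e := by rw [← mul_add]; gcongr
    _ ≤ (c * p') * (c' * x') + 1 * e := by gcongr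
    _ = _ := by ring

lemma mul_le_of_le_weight {c q q' y y' e : ℝ≥0∞} (h : q ≤ q') (hq : q' ≤ 1)
    (hy : y ≤ c * y' + e) : q * y ≤ c * (q' * y') + e :=
  calc q * y ≤ q' * (c * y') + q' * e := by rw [← mul_add]; gcongr
    _ ≤ q' * (c * y') + 1 * e := by gcongr
    _ = _ := by ring

lemma mix_le_of_skip {c p q x y y' e γ : ℝ≥0∞} (hp : p ≤ γ) (hq : q ≤ 1) (hx : x ≤ 1)
    (hy : y ≤ c * y' + e) : p * x + q * y ≤ c * y' + (e + γ) :=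
  calc p * x + q * y ≤ γ * 1 + 1 * (c * y' + e) := by gcongr
    _ = _ := by ring

lemma le_mix_of_skip {c p' q' x' y y' e γ : ℝ≥0∞} (hpq : p' + q' = 1) (hp : p' ≤ γ) (h1 : y ≤ 1)
    (hy : y ≤ c * y' + e) : y ≤ c * (p' * x' + q' * y') + (e + γ) :=
  calc y = p' * y + q' * y := by rw [← add_mul, hpq, one_mul]
    _ ≤ _ := (mix_le (e₁ := γ) (mul_le_of_small hp h1)
        (mul_le_of_le_weight le_rfl (hpq ▸ le_add_self) hy)).trans_eq (by rw [add_comm γ])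

lemma measurableSet_test (P : Prop) (a b : ℝ) : MeasurableSet {s : ℝ | P ∧ a ≤ b + s} :=
  (MeasurableSet.const _).inter
    (measurableSet_le measurable_const (measurable_const.add measurable_id))

lemma lintegral_heavyWalk_succ {ε : ℝ} (t : ℕ) (D : Multiset ℕ) (ρ : ℝ) (h i : ℕ) (g : ℕ → ℝ≥0∞) :
    ∫⁻ z, g z ∂(heavyWalk ε t D ρ (h + 1) i) =
      lap (1 / ε) {s | (t : ℝ) / 10 < (minWeight D h i : ℝ) ∧
        (t : ℝ) / 4 + ρ ≤ (minWeight D h i : ℝ) + s} * g (leftRightLeaf h i) +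
      lap (1 / ε) {s | ¬ ((t : ℝ) / 10 < (minWeight D h i : ℝ) ∧
        (t : ℝ) / 4 + ρ ≤ (minWeight D h i : ℝ) + s)} *
        ∫⁻ z, g z ∂(heavyWalk ε t D ρ h (heavyChild D h i)) := by
  rw [heavyWalk, lintegral_bind_ite _ (measurableSet_test _ _ _) _ _ Measurable.of_discrete,
    lintegral_dirac]

lemma lintegral_heavyWalk_skip {ε : ℝ} (hε : 0 < ε) {t : ℕ} {D : Multiset ℕ} (ρ : ℝ) {h i : ℕ}
    (hw : ¬ (t : ℝ) / 10 < (minWeight D h i : ℝ)) (g : ℕ → ℝ≥0∞) :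
    ∫⁻ z, g z ∂(heavyWalk ε t D ρ (h + 1) i) =
      ∫⁻ z, g z ∂(heavyWalk ε t D ρ h (heavyChild D h i)) := by
  have := isProbabilityMeasure_lap (one_div_pos.2 hε)
  rw [lintegral_heavyWalk_succ]
  simp only [hw, false_and, not_false_eq_true, Set.ofPred_false, Set.ofPred_true, measure_empty,
    measure_univ, zero_mul, one_mul, zero_add]

/-- Sparse vector technique with the threshold for `D'` raised by `2 * d`. Passing a vertex is then
free, and only the final stop costs `4 * d * ε`. The number `m` is a budget for vertices tested for
one data set only, where stopping has probability at most `γ`. -/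
lemma close_heavyWalk {ε : ℝ} (hε : 0 < ε) {t d : ℕ} {D D' : Multiset ℕ} (hD : TailClose d D D')
    {γ : ℝ≥0∞} (hγ : lossFactor (-(ε * t / 20)) ≤ γ) (ht : 0 < t) (hd : 200 * d ≤ t) {ρ : ℝ}
    (hρ : |ρ| ≤ (t : ℝ) / 20) : ∀ h i m : ℕ, 9 * t ≤ 20 * gammaFrom D h i →
      20 * weight D h i ≤ m * t →
      Close (lossFactor (4 * d * ε)) ((m + 1) * γ) (heavyWalk ε t D ρ h i)
        (heavyWalk ε t D' (ρ + 2 * d) h i)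
  | 0, i, m, h0, _ => by simp [gammaFrom] at h0; omega
  | h + 1, i, m, hG, hm => by
    have hb : 0 < 1 / ε := one_div_pos.2 hε
    have hlap := isProbabilityMeasure_lap hb
    have ht' : (0 : ℝ) < t := by exact_mod_cast ht
    have hd' : 200 * (d : ℝ) ≤ t := by exact_mod_cast hd
    obtain ⟨hρ1, hρ2⟩ := abs_le.1 hρ
    set w := minWeight D h i with hw
    set w' := minWeight D' h i with hw'
    have hww : (w : ℝ) ≤ w' + 2 * d := by exact_mod_cast hD.minWeight h i
    have hww' : (w' : ℝ) ≤ w + 2 * d := by exact_mod_cast hD.symm.minWeight h i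
    have tail_eq : -((t : ℝ) / 20) / (1 / ε) = -(ε * t / 20) := by field_simp
    have mA := measurableSet_test ((t : ℝ) / 10 < (w : ℝ)) ((t : ℝ) / 4 + ρ) w
    have mA' := measurableSet_test ((t : ℝ) / 10 < (w' : ℝ)) ((t : ℝ) / 4 + (ρ + 2 * d)) w'
    have hpq' := measure_add_not (lap (1 / ε)) mA'
    have hp : (t : ℝ) / 10 < w' → lap (1 / ε) {s | (t : ℝ) / 10 < (w : ℝ) ∧
        (t : ℝ) / 4 + ρ ≤ (w : ℝ) + s} ≤ lossFactor (4 * d * ε) *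
        lap (1 / ε) {s | (t : ℝ) / 10 < (w' : ℝ) ∧ (t : ℝ) / 4 + (ρ + 2 * d) ≤ (w' : ℝ) + s} := by
      intro h1
      refine lap_shift_const_le hb mA mA' (4 * d) (fun s hs => ⟨h1, ?_⟩) ?_
      · have := hs.2
        linarith
      · rw [abs_of_nonneg (by positivity), div_div_eq_mul_div, div_one]
    have hprob := (heavyWalk_props hε t D h (heavyChild D h i)).2 ρ
    intro g hg hg1
    have hy := lintegral_le_one (heavyWalk ε t D ρ h (heavyChild D h i)) hg1
    -- At so balanced a vertex the walk of `D` stops except with probability `γ`, so the paths below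
    -- need not be compared.
    by_cases hA : 9 * t ≤ 20 * w
    · have hA' : 9 * (t : ℝ) ≤ 20 * w := by exact_mod_cast hA
      rw [lintegral_heavyWalk_succ, lintegral_heavyWalk_succ]
      have hq : lap (1 / ε) {s | ¬ ((t : ℝ) / 10 < (w : ℝ) ∧
          (t : ℝ) / 4 + ρ ≤ (w : ℝ) + s)} ≤ γ := by
        refine le_trans ?_ hγ
        rw [← tail_eq]
        refine lap_lower_tail hb mA.compl (by positivity) fun s hs => ?_
        by_contra hcon
        exact hs ⟨by linarith, by linarith⟩
      have hw10 : (t : ℝ) / 10 < w' := by linarith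
      refine le_trans ?_ (add_le_add_right (le_mul_of_one_le_left' (le_add_self (a := 1))) _)
      rw [← zero_add γ]
      exact mix_le (mul_le_of_factor (hp hw10)) (mul_le_of_small hq hy)
    -- The required vertex lies further down, so the heavy child weighs at least `9t/10`, more than
    -- `w + 4 * d`; the paths cannot part here.
    · have hG' : 9 * t ≤ 20 * gammaFrom D h (heavyChild D h i) := by
        rw [gammaFrom] at hG; omega
      have hchild : heavyChild D h i = heavyChild D' h i := by
        by_contra hne
        have h1 := (heavyChild_ne hD hne).2
        have h2 := two_mul_gammaFrom_le D h (heavyChild D h i)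
        omega
      have hwt := weight_succ_eq D h i
      have ih := fun m' => close_heavyWalk hε hD hγ ht hd hρ h (heavyChild D h i) m' hG'
      -- In either case `w > t/20`, so the step to the heavy child sheds enough weight to release
      -- one unit of the budget.
      have hm1 : ((t : ℝ) / 10 < w ∨ (t : ℝ) / 10 < w') →
          ∃ m', m = m' + 1 ∧ 20 * weight D h (heavyChild D h i) ≤ m' * t := by
        intro h1
        have h3 : t < 20 * w := by
          have : (t : ℝ) < 20 * w := by rcases h1 with h1 | h1 <;> linarith
          exact_mod_cast this
        rcases m with _ | m'
        · omega
        · refine ⟨m', rfl, ?_⟩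
          rw [hwt, Nat.add_mul] at hm
          omega
      by_cases h1 : (t : ℝ) / 10 < w <;> by_cases h2 : (t : ℝ) / 10 < w'
      · have ihg := ih m (by rw [hwt] at hm; omega) g hg hg1
        rw [lintegral_heavyWalk_succ, lintegral_heavyWalk_succ, ← hchild]
        -- Since `w' ≤ w + 2 * d`, the raised threshold makes the test of `D'` fail for the same
        -- noise whenever that of `D` fails.
        have hq : lap (1 / ε) {s | ¬ ((t : ℝ) / 10 < (w : ℝ) ∧ (t : ℝ) / 4 + ρ ≤ (w : ℝ) + s)} ≤
            lap (1 / ε) {s | ¬ ((t : ℝ) / 10 < (w' : ℝ) ∧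
              (t : ℝ) / 4 + (ρ + 2 * d) ≤ (w' : ℝ) + s)} :=
          measure_mono fun s hs hs' => hs ⟨h1, by have := hs'.2; linarith⟩
        exact (mix_le (mul_le_of_factor (hp h2))
          (mul_le_of_le_weight hq (hpq' ▸ le_add_self) ihg)).trans_eq (by rw [zero_add])
      · obtain ⟨m', rfl, hm'⟩ := hm1 (Or.inl h1)
        have hsmall : lap (1 / ε) {s | (t : ℝ) / 10 < (w : ℝ) ∧
            (t : ℝ) / 4 + ρ ≤ (w : ℝ) + s} ≤ γ := by
          refine le_trans ?_ hγ
          rw [← tail_eq]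
          refine lap_upper_tail hb mA (by positivity) fun s hs => ?_
          have := hs.2
          linarith
        rw [lintegral_heavyWalk_skip hε _ h2, lintegral_heavyWalk_succ, ← hchild]
        exact (mix_le_of_skip hsmall prob_le_one (hg1 _) (ih m' hm' g hg hg1)).trans_eq
          (by push_cast; ring)
      · obtain ⟨m', rfl, hm'⟩ := hm1 (Or.inr h2)
        have hsmall : lap (1 / ε) {s | (t : ℝ) / 10 < (w' : ℝ) ∧
            (t : ℝ) / 4 + (ρ + 2 * d) ≤ (w' : ℝ) + s} ≤ γ := by
          refine le_trans ?_ hγ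
          rw [← tail_eq]
          refine lap_upper_tail hb mA' (by positivity) fun s hs => ?_
          have := hs.2
          linarith
        rw [lintegral_heavyWalk_skip hε _ h1, lintegral_heavyWalk_succ, ← hchild]
        rw [show (((m' + 1 : ℕ) : ℝ≥0∞) + 1) * γ = (m' + 1) * γ + γ by push_cast; ring]
        exact le_mix_of_skip hpq' hsmall hy (ih m' hm' g hg hg1)
      · have ihg := ih m (by rw [hwt] at hm; omega) g hg hg1
        rw [lintegral_heavyWalk_skip hε _ h1, lintegral_heavyWalk_skip hε _ h2, ← hchild]
        exact ihg

lemma lap_abs_tail {ε u : ℝ} (hε : 0 < ε) (hu : 0 ≤ u) :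
    lap (1 / ε) {s | ¬ |s| ≤ u} ≤ 2 * lossFactor (-(ε * u)) := by
  have hb : 0 < 1 / ε := one_div_pos.2 hε
  have e : -u / (1 / ε) = -(ε * u) := by field_simp
  calc lap (1 / ε) {s | ¬ |s| ≤ u} ≤ lap (1 / ε) ({s | u ≤ s} ∪ {s | s ≤ -u}) :=
        measure_mono fun s hs => by
          rcases lt_abs.1 (not_le.1 hs) with h | h
          · exact Or.inl h.le
          · exact Or.inr (by simp only [Set.mem_ofPred_eq]; linarith)
    _ ≤ _ := measure_union_le _ _
    _ ≤ lossFactor (-u / (1 / ε)) + lossFactor (-u / (1 / ε)) :=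
        add_le_add (lap_upper_tail hb measurableSet_Ici hu fun _ h => h)
          (lap_lower_tail hb measurableSet_Iic hu fun _ h => h)
    _ = _ := by rw [e, two_mul]

/-- Shifting the threshold noise by `2 * d` adds `2 * d * ε` to the loss of the walk, and the event
`|ρ| > t/20` adds `2 * γ`. -/
lemma close_oneHeavyRound {ε : ℝ} (hε : 0 < ε) {t d : ℕ} {D D' : Multiset ℕ}
    (hD : TailClose d D D') {γ : ℝ≥0∞} (hγ : lossFactor (-(ε * t / 20)) ≤ γ) (ht : 0 < t)
    (hd : 200 * d ≤ t) {k m : ℕ} (hG : 9 * t ≤ 20 * Gam k D) (hm : 20 * D.card ≤ m * t) :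
    Close (lossFactor (6 * d * ε)) ((m + 3) * γ) (oneHeavyRound ε t k D)
      (oneHeavyRound ε t k D') := by
  have hb : 0 < 1 / ε := one_div_pos.2 hε
  have hlap := isProbabilityMeasure_lap hb
  intro g hg hg1
  have hmeas : ∀ E : Multiset ℕ, Measurable fun ρ => ∫⁻ z, g z ∂(heavyWalk ε t E ρ k 0) := fun E =>
    (Measure.measurable_lintegral hg).comp (heavyWalk_props hε t E k 0).1
  rw [oneHeavyRound, oneHeavyRound,
    Measure.lintegral_bind (heavyWalk_props hε t D k 0).1.aemeasurable hg.aemeasurable,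
    Measure.lintegral_bind (heavyWalk_props hε t D' k 0).1.aemeasurable hg.aemeasurable]
  have hmeas2 : Measurable fun ρ : ℝ => ∫⁻ z, g z ∂(heavyWalk ε t D' (ρ + 2 * d) k 0) :=
    (hmeas D').comp (measurable_add_const _)
  have hw : 20 * weight D k 0 ≤ m * t :=
    (Nat.mul_le_mul_left _ (Multiset.countP_le_card _ _)).trans hm
  have step := lintegral_le_indicator (lap (1 / ε)) (β := 2 * γ)
    (G := fun ρ => ∫⁻ z, g z ∂(heavyWalk ε t D ρ k 0))
    (H := fun ρ => lossFactor (4 * d * ε) * ∫⁻ z, g z ∂(heavyWalk ε t D' (ρ + 2 * d) k 0))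
    (e := (m + 1) * γ) (B := {ρ : ℝ | ¬ |ρ| ≤ (t : ℝ) / 20})
    ((measurableSet_le measurable_norm measurable_const).compl)
    ((lap_abs_tail hε (by positivity)).trans (by
      rw [← mul_div_assoc]; gcongr))
    (fun ρ => have := (heavyWalk_props hε t D k 0).2 ρ; lintegral_le_one _ hg1)
    (hmeas2.const_mul _)
    (fun ρ hρ => close_heavyWalk hε hD hγ ht hd (not_not.1 hρ) k 0 m hG hw g hg hg1)
  refine step.trans ?_
  rw [lintegral_const_mul _ hmeas2]
  have shift := lintegral_lap_le_shift hb (hmeas D') (2 * d)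
  rw [abs_of_nonneg (by positivity), div_div_eq_mul_div, div_one] at shift
  calc _ ≤ lossFactor (4 * d * ε) * (lossFactor (2 * d * ε) * _) + _ := by gcongr
    _ = _ := by
      rw [← mul_assoc, ← lossFactor_add]
      congr 1
      · congr 2; ring
      · ring

/-! ### The choosing mechanism -/

lemma sup_le_sup_add {Z : Finset ℕ} {q q' : ℕ → ℕ} {Δ : ℕ} (h : ∀ z ∈ Z, q z ≤ q' z + Δ) :
    Z.sup q ≤ Z.sup q' + Δ :=
  Finset.sup_le fun z hz => (h z hz).trans (by gcongr; exact Finset.le_sup hz)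

lemma card_filter_one_le {Z : Finset ℕ} {q : ℕ → ℕ} {T : ℕ} (h : ∑ z ∈ Z, q z ≤ T) :
    (Z.filter fun z => 1 ≤ q z).card ≤ T := by
  refine le_trans ?_ h
  rw [Finset.card_eq_sum_ones]
  refine (Finset.sum_le_sum fun z hz => (Finset.mem_filter.1 hz).2).trans ?_
  exact Finset.sum_le_sum_of_subset (Finset.filter_subset _ _)

/-- The supports may differ, but a solution in only one of them has quality at most `Δ`, and each
support has at most `T` elements. Against a normalising sum of at least `A` such solutions are
negligible. They enter twice: through lost mass and through the change of the normalising sum. -/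
lemma close_expMech_support {ε : ℝ} (hε : 0 < ε) {Z : Finset ℕ} {q q' : ℕ → ℕ} {Δ T : ℕ}
    (h : ∀ z ∈ Z, q z ≤ q' z + Δ) (h' : ∀ z ∈ Z, q' z ≤ q z + Δ) (hT : ∑ z ∈ Z, q z ≤ T)
    (hT' : ∑ z ∈ Z, q' z ≤ T) (hne : (Z.filter fun z => 1 ≤ q' z).Nonempty) {A : ℝ} (hA : 0 < A)
    (hS : A ≤ ∑ z ∈ Z.filter (fun z => 1 ≤ q z), Real.exp (ε * q z / 2)) :
    Close (lossFactor (ε * Δ)) (ENNReal.ofReal (2 * Real.exp (ε * Δ) * (T / A)))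
      (expMech ε (Z.filter fun z => 1 ≤ q z) fun z => q z)
      (expMech ε (Z.filter fun z => 1 ≤ q' z) fun z => q' z) := fun g _ hg1 => by
  rw [lintegral_expMech, lintegral_expMech]
  set S := ∑ z ∈ Z.filter (fun z => 1 ≤ q z), Real.exp (ε * q z / 2) with hSdef
  set S' := ∑ z ∈ Z.filter (fun z => 1 ≤ q' z), Real.exp (ε * q' z / 2) with hSdef'
  set E := Real.exp (ε * Δ / 2) with hE
  have hEE : Real.exp (ε * Δ) = E * E := by rw [hE, ← Real.exp_add]; congr 1; ring
  have hE1 : 1 ≤ E := Real.one_le_exp (by positivity)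
  have hS0 : 0 < S := hA.trans_le hS
  have hS0' : 0 < S' := Finset.sum_pos (fun _ _ => Real.exp_pos _) hne
  have hq : ∀ u v : ℕ, u ≤ v + Δ → Real.exp (ε * u / 2) ≤ E * Real.exp (ε * v / 2) := by
    intro u v huv
    rw [hE, ← Real.exp_add]
    refine Real.exp_le_exp.2 ?_
    have : (u : ℝ) ≤ v + Δ := by exact_mod_cast huv
    have := mul_le_mul_of_nonneg_left this hε.le
    linarith
  have hTS : (T : ℝ) / S ≤ T / A := by gcongr
  -- Solutions of positive quality for `q` are covered by `S`; each of the at most `T` others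
  -- contributes `exp 0 = 1` before the factor `E`.
  have hS'le : S' ≤ E * (S + T) := by
    calc S' ≤ ∑ z ∈ Z.filter (fun z => 1 ≤ q' z), E * Real.exp (ε * q z / 2) :=
          Finset.sum_le_sum fun z hz => hq _ _ (h' z (Finset.mem_filter.1 hz).1)
      _ = E * ∑ z ∈ Z.filter (fun z => 1 ≤ q' z), Real.exp (ε * q z / 2) := by
          rw [Finset.mul_sum]
      _ ≤ E * ∑ z ∈ Z.filter (fun z => 1 ≤ q' z),
            ((if 1 ≤ q z then Real.exp (ε * q z / 2) else 0) + 1) := by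
          gcongr with z hz
          split_ifs with h1
          · linarith
          · have : q z = 0 := by omega
            simp [this]
      _ ≤ E * (S + T) := by
          rw [Finset.sum_add_distrib]
          gcongr
          · rw [hSdef, Finset.sum_filter (fun z => 1 ≤ q z)]
            refine Finset.sum_le_sum_of_subset_of_nonneg (Finset.filter_subset _ _) fun z _ _ => ?_
            split_ifs <;> positivity
          · rw [Finset.sum_const, nsmul_eq_mul, mul_one]
            exact_mod_cast card_filter_one_le hT'
  have split : ∀ z ∈ Z.filter (fun z => 1 ≤ q z),
      ENNReal.ofReal (Real.exp (ε * q z / 2) / S) * g z ≤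
        (if 1 ≤ q' z then lossFactor (ε * Δ) * (ENNReal.ofReal (Real.exp (ε * q' z / 2) / S') * g z) +
          ENNReal.ofReal (E * E * (T / A)) * ENNReal.ofReal (Real.exp (ε * q' z / 2) / S') else 0) +
        ENNReal.ofReal (E / A) := by
    intro z hz
    obtain ⟨hzZ, hz1⟩ := Finset.mem_filter.1 hz
    split_ifs with hz'
    · refine le_trans ?_ le_self_add
      have key : Real.exp (ε * q z / 2) / S ≤
          (Real.exp (ε * Δ) + E * E * (T / A)) * (Real.exp (ε * q' z / 2) / S') := by
        calc Real.exp (ε * q z / 2) / S ≤ E * Real.exp (ε * q' z / 2) / S := by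
              gcongr; exact hq _ _ (h z hzZ)
          _ = E * Real.exp (ε * q' z / 2) / S * (S' / S') := by
              rw [div_self hS0'.ne', mul_one]
          _ ≤ E * Real.exp (ε * q' z / 2) / S * (E * (S + T) / S') := by gcongr
          _ = (E * E + E * E * (T / S)) * (Real.exp (ε * q' z / 2) / S') := by
              field_simp
          _ ≤ _ := by rw [hEE]; gcongr
      calc _ ≤ ENNReal.ofReal ((Real.exp (ε * Δ) + E * E * (T / A)) *
              (Real.exp (ε * q' z / 2) / S')) * g z := by gcongr
        _ = lossFactor (ε * Δ) * (ENNReal.ofReal (Real.exp (ε * q' z / 2) / S') * g z) +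
            ENNReal.ofReal (E * E * (T / A)) * ENNReal.ofReal (Real.exp (ε * q' z / 2) / S') *
              g z := by
            rw [ENNReal.ofReal_mul (by positivity), ENNReal.ofReal_add (by positivity)
              (by positivity), lossFactor]
            ring
        _ ≤ _ := add_le_add le_rfl (mul_le_of_le_one_right' (hg1 z))
    · rw [zero_add]
      refine (mul_le_of_le_one_right' (hg1 z)).trans (ENNReal.ofReal_le_ofReal ?_)
      have h0 : q' z = 0 := by omega
      have := hq (q z) (q' z) (h z hzZ)
      rw [h0] at this
      simp only [Nat.cast_zero, mul_zero, zero_div, Real.exp_zero, mul_one] at this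
      gcongr
  refine (Finset.sum_le_sum split).trans ?_
  rw [Finset.sum_add_distrib, ← Finset.sum_filter, Finset.sum_add_distrib, ← Finset.mul_sum,
    ← Finset.mul_sum, add_assoc]
  have hsub : ((Z.filter fun z => 1 ≤ q z).filter fun z => 1 ≤ q' z) ⊆
      Z.filter fun z => 1 ≤ q' z := Finset.filter_subset_filter _ (Finset.filter_subset _ _)
  refine add_le_add (by gcongr) ?_
  have hone : ∑ z ∈ (Z.filter fun z => 1 ≤ q z).filter (fun z => 1 ≤ q' z),
      ENNReal.ofReal (Real.exp (ε * q' z / 2) / S') ≤ 1 := by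
    refine (Finset.sum_le_sum_of_subset hsub).trans ?_
    rw [← ENNReal.ofReal_sum_of_nonneg (fun _ _ => by positivity), ← Finset.sum_div,
      div_self hS0'.ne', ENNReal.ofReal_one]
  have hcard : ∑ _z ∈ Z.filter (fun z => 1 ≤ q z), ENNReal.ofReal (E / A) ≤
      ENNReal.ofReal (E * E * (T / A)) := by
    rw [Finset.sum_const, nsmul_eq_mul, ← ENNReal.ofReal_natCast, ← ENNReal.ofReal_mul (by positivity)]
    refine ENNReal.ofReal_le_ofReal ?_
    have : ((Z.filter fun z => 1 ≤ q z).card : ℝ) ≤ T := by exact_mod_cast card_filter_one_le hT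
    calc _ ≤ (T : ℝ) * (E / A) := by gcongr
      _ = 1 * E * (T / A) := by ring
      _ ≤ _ := by gcongr
  calc _ ≤ ENNReal.ofReal (E * E * (T / A)) * 1 + ENNReal.ofReal (E * E * (T / A)) := by gcongr
    _ = _ := by
      rw [mul_one, ← ENNReal.ofReal_add (by positivity) (by positivity), hEE]
      congr 1; ring

/-- The qualities may all move by `Δ`, so growth boundedness is replaced by the bound `T` on their
sum. A small optimum makes success improbable; a large one makes the normalising sum at least `4 /
(ε δ ^ 2)`. The test costs `ε Δ / 4` and the exponential mechanism `ε Δ / 2`. -/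
lemma close_choosingMech {ε δ : ℝ} (hε : 0 < ε) (hε1 : ε ≤ 1) (hδ : 0 < δ)
    (hδ1 : δ ≤ Real.exp (-10)) {Z : Finset ℕ} {q q' : ℕ → ℕ} {Δ T : ℕ} (hΔ : ε * Δ ≤ 16)
    (h : ∀ z ∈ Z, q z ≤ q' z + Δ) (h' : ∀ z ∈ Z, q' z ≤ q z + Δ) (hT : ∑ z ∈ Z, q z ≤ T)
    (hT' : ∑ z ∈ Z, q' z ≤ T) (hTδ : ε * T * δ ≤ 202) (z₀ : ℕ) :
    Close (lossFactor (3 / 4 * (ε * Δ))) (ENNReal.ofReal (700000 * δ))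
      (choosingMech ε δ δ 1 Z q z₀) (choosingMech ε δ δ 1 Z q' z₀) := by
  have hb : 0 < 4 / ε := by positivity
  have hlap := isProbabilityMeasure_lap hb
  set ℓ := Real.log (4 * 1 / (δ * ε * δ)) with hℓ
  have hx0 : 0 < 4 * 1 / (δ * ε * δ) := by positivity
  have hδ1' : δ ≤ 1 := hδ1.trans (Real.exp_le_one_iff.2 (by norm_num))
  have hδεδ : δ * ε * δ ≤ δ := by
    calc δ * ε * δ ≤ 1 * 1 * δ := by gcongr
      _ = δ := by ring
  -- In the case of a large optimum this gives `ε M ≥ 4 ℓ > 16 ≥ ε Δ`, so the optimal solution keeps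
  -- positive quality for `q'`.
  have hℓ4 : 4 < ℓ := by
    rw [hℓ, Real.lt_log_iff_exp_lt hx0, lt_div_iff₀ (by positivity)]
    calc Real.exp 4 * (δ * ε * δ) ≤ Real.exp 4 * Real.exp (-10) := by
          gcongr; exact hδεδ.trans hδ1
      _ = Real.exp (-6) := by rw [← Real.exp_add]; norm_num
      _ ≤ 1 := Real.exp_le_one_iff.2 (by norm_num)
      _ < 4 * 1 := by norm_num
  set M := Z.sup q with hM
  set M' := Z.sup q' with hM'
  have hMM : (M : ℝ) ≤ M' + Δ := by exact_mod_cast sup_le_sup_add h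
  have hMM' : (M' : ℝ) ≤ M + Δ := by exact_mod_cast sup_le_sup_add h'
  have mlt : ∀ c : ℝ, MeasurableSet {s : ℝ | c + s < 8 / ε * ℓ} := fun c =>
    measurableSet_lt (measurable_const.add measurable_id) measurable_const
  have mF : ∀ (c : ℝ) (P : Prop), MeasurableSet {s : ℝ | c + s < 8 / ε * ℓ ∨ P} := fun c P =>
    (mlt c).union (MeasurableSet.const _)
  have shiftη : |(-(Δ : ℝ))| / (4 / ε) ≤ ε * Δ / 4 := by
    rw [abs_neg, abs_of_nonneg (by positivity)]
    apply le_of_eq; field_simp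
  have shiftη' : |(Δ : ℝ)| / (4 / ε) ≤ ε * Δ / 4 := by rwa [abs_neg] at shiftη
  have hη0 : 0 ≤ ε * Δ := by positivity
  intro g hg hg1
  rw [choosingMech, choosingMech, lintegral_bind_ite _ (mF _ _) _ _ hg,
    lintegral_bind_ite _ (mF _ _) _ _ hg]
  by_cases hc : (M : ℝ) < 4 / ε * ℓ
  · have hβ : lap (4 / ε) {s | 4 / ε * ℓ ≤ s} ≤ ENNReal.ofReal δ := by
      refine (lap_upper_tail hb measurableSet_Ici (u := 4 / ε * ℓ) (by positivity)
        fun _ h => h).trans ?_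
      rw [lossFactor]
      refine ENNReal.ofReal_le_ofReal ?_
      rw [show -(4 / ε * ℓ) / (4 / ε) = -ℓ by field_simp, Real.exp_neg, hℓ, Real.exp_log hx0, inv_div]
      linarith
    have hprob : ∫⁻ z, g z ∂(if Z.filter (fun z => 1 ≤ q z) = ∅ then Measure.dirac z₀
        else expMech (ε / 2) (Z.filter (fun z => 1 ≤ q z)) (fun z => (q z : ℝ))) ≤ 1 := by
      split_ifs with h0
      · have : IsProbabilityMeasure (Measure.dirac z₀) := inferInstance
        exact lintegral_le_one _ hg1
      · have := isProbabilityMeasure_expMech (ε / 2) (Finset.nonempty_iff_ne_empty.2 h0)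
          (fun z => (q z : ℝ))
        exact lintegral_le_one _ hg1
    have hF : lap (4 / ε) {s | (M : ℝ) + s < 8 / ε * ℓ ∨ Z.filter (fun z => 1 ≤ q z) = ∅} ≤
        lossFactor (3 / 4 * (ε * Δ)) *
          lap (4 / ε) {s | (M' : ℝ) + s < 8 / ε * ℓ ∨ Z.filter (fun z => 1 ≤ q' z) = ∅} +
          ENNReal.ofReal δ := by
      calc _ ≤ lap (4 / ε) ({s | (M : ℝ) + s < 8 / ε * ℓ} ∪ {s | 4 / ε * ℓ ≤ s}) := by
            refine measure_mono fun s _ => ?_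
            by_cases hs : (M : ℝ) + s < 8 / ε * ℓ
            · exact Or.inl hs
            · refine Or.inr ?_
              have : 8 / ε * ℓ = 4 / ε * ℓ + 4 / ε * ℓ := by ring
              simp only [Set.mem_ofPred_eq]
              linarith
        _ ≤ _ := measure_union_le _ _
        _ ≤ _ := by
            refine add_le_add ?_ hβ
            refine lap_shift_const_le hb (mlt _) (mF _ _) (-(Δ : ℝ)) (fun s hs => Or.inl ?_)
              (shiftη.trans (by linarith))
            simp only [Set.mem_ofPred_eq] at hs
            linarith
    have hq : lap (4 / ε) {s | ¬ ((M : ℝ) + s < 8 / ε * ℓ ∨ Z.filter (fun z => 1 ≤ q z) = ∅)} *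
        ∫⁻ z, g z ∂(expMech (ε / 2) (Z.filter (fun z => 1 ≤ q z)) (fun z => (q z : ℝ))) ≤
        ENNReal.ofReal δ := by
      by_cases h0 : Z.filter (fun z => 1 ≤ q z) = ∅
      · simp [h0]
      · rw [if_neg h0] at hprob
        refine (mul_le_mul' ((measure_mono fun s hs => ?_).trans hβ) hprob).trans_eq (mul_one _)
        have h1 : ¬ (M : ℝ) + s < 8 / ε * ℓ := fun h => hs (Or.inl h)
        have : 8 / ε * ℓ = 4 / ε * ℓ + 4 / ε * ℓ := by ring
        simp only [Set.mem_ofPred_eq]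
        linarith
    have h2δ : ENNReal.ofReal δ + ENNReal.ofReal δ ≤ ENNReal.ofReal (700000 * δ) := by
      rw [← ENNReal.ofReal_add hδ.le hδ.le]
      exact ENNReal.ofReal_le_ofReal (by linarith)
    refine le_trans ?_ (add_le_add_right h2δ _)
    refine mix_le ?_ (hq.trans le_add_self)
    rw [lintegral_dirac]
    calc _ ≤ (_ + ENNReal.ofReal δ) * g z₀ := by gcongr
      _ = _ + ENNReal.ofReal δ * g z₀ := by rw [add_mul, mul_assoc]
      _ ≤ _ := add_le_add le_rfl (mul_le_of_le_one_right' (hg1 _))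
  · rw [not_lt] at hc
    have hcε : 4 * ℓ ≤ ε * M := by
      have := mul_le_mul_of_nonneg_left hc hε.le
      rwa [← mul_assoc, mul_div_cancel₀ _ hε.ne'] at this
    have hM0 : 0 < M := by
      by_contra h0
      rw [Nat.eq_zero_of_not_pos h0] at hcε
      simp at hcε
      linarith
    have hZ : Z.Nonempty := by
      by_contra h0
      rw [Finset.not_nonempty_iff_eq_empty] at h0
      simp [hM, h0] at hM0
    obtain ⟨z, hz, hzM⟩ := Finset.exists_mem_eq_sup Z hZ q
    have hzq : z ∈ Z.filter fun z => 1 ≤ q z := Finset.mem_filter.2 ⟨hz, by omega⟩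
    have hne' : (Z.filter fun z => 1 ≤ q' z).Nonempty := by
      refine ⟨z, Finset.mem_filter.2 ⟨hz, ?_⟩⟩
      by_contra h0
      have h1 := h z hz
      have h2 : M ≤ Δ := by omega
      have h3 : (M : ℝ) ≤ Δ := by exact_mod_cast h2
      have := mul_le_mul_of_nonneg_left h3 hε.le
      linarith
    have e1 := Finset.nonempty_iff_ne_empty.1 ⟨z, hzq⟩
    have e2 := Finset.nonempty_iff_ne_empty.1 hne'
    simp only [e1, e2, or_false]
    have hS : 4 * 1 / (δ * ε * δ) ≤
        ∑ z ∈ Z.filter (fun z => 1 ≤ q z), Real.exp (ε / 2 * q z / 2) := by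
      refine le_trans ?_ (Finset.single_le_sum (f := fun z => Real.exp (ε / 2 * q z / 2))
        (fun _ _ => (Real.exp_pos _).le) hzq)
      rw [← Real.log_le_iff_le_exp hx0, ← hzM]
      linarith
    have hexp := close_expMech_support (half_pos hε) h h' hT hT' hne' hx0 hS
    have herr : 2 * Real.exp (ε / 2 * Δ) * (T / (4 * 1 / (δ * ε * δ))) ≤ 700000 * δ := by
      -- From `ε Δ ≤ 16` and `exp 8 ≤ 3 ^ 8`; the constant `700000` rounds up `2 * 6561 * 202 / 4`.
      have h8 : Real.exp (ε / 2 * Δ) ≤ 6561 := by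
        calc Real.exp (ε / 2 * Δ) ≤ Real.exp ((8 : ℕ) * 1) :=
              Real.exp_le_exp.2 (by push_cast; linarith)
          _ = Real.exp 1 ^ 8 := Real.exp_nat_mul 1 8
          _ ≤ 3 ^ 8 := by gcongr; exact Real.exp_one_lt_three.le
          _ = 6561 := by norm_num
      have h9 : (T : ℝ) / (4 * 1 / (δ * ε * δ)) = (ε * T * δ) * δ / 4 := by
        field_simp
      rw [h9]
      calc _ ≤ 2 * 6561 * (202 * δ / 4) := by gcongr
        _ ≤ _ := by linarith
    have y1 := (hexp g hg hg1).trans (add_le_add_right (ENNReal.ofReal_le_ofReal herr) _)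
    have p1 := lap_shift_const_le hb (mlt M) (mlt M') (-(Δ : ℝ)) (fun s hs => by
      simp only [Set.mem_ofPred_eq] at hs ⊢; linarith) shiftη
    have p2 := lap_shift_const_le hb (mlt M).compl (mlt M').compl (Δ : ℝ) (fun s hs => by
      simp only [Set.mem_compl_iff, Set.mem_ofPred_eq, not_lt] at hs ⊢; linarith) shiftη'
    have hfac : lossFactor (3 / 4 * (ε * Δ)) = lossFactor (ε * Δ / 4) * lossFactor (ε / 2 * Δ) := by
      rw [← lossFactor_add]; congr 1; ring
    have p1' := p1.trans (mul_le_mul_left (lossFactor_mono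
      (show ε * Δ / 4 ≤ 3 / 4 * (ε * Δ) by linarith)) _)
    rw [← zero_add (ENNReal.ofReal (700000 * δ))]
    refine mix_le (mul_le_of_factor p1') ?_
    rw [hfac]
    exact mul_le_of_close p2 prob_le_one y1

/-- The choosing mechanism with `Δ = 16 * d` costs `12 * d * ε`, and the final choice, scored on
data of distance `2 * d`, costs `2 * d * ε`. -/
lemma close_finishLevel {ε δ : ℝ} (hε : 0 < ε) (hε1 : ε ≤ 1) (hδ : 0 < δ)
    (hδ1 : δ ≤ Real.exp (-10)) {d T : ℕ} (hd : ε * d ≤ 1) (hTδ : ε * T * δ ≤ 202) (k : ℕ)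
    {Sd Sd' Sb Sb' : Multiset ℕ} (hw : ∀ h i, weight Sd h i ≤ weight Sd' h i + 16 * d)
    (hw' : ∀ h i, weight Sd' h i ≤ weight Sd h i + 16 * d) (hc : Sd.card ≤ T) (hc' : Sd'.card ≤ T)
    (hSb : TailClose (2 * d) Sb Sb') (q : ℕ) :
    Close (lossFactor (14 * d * ε)) (ENNReal.ofReal (700000 * δ))
      (finishLevel ε δ k Sd Sb q) (finishLevel ε δ k Sd' Sb' q) := by
  have := isProbabilityMeasure_choosingMech hε δ δ 1 (Finset.range (2 ^ q))
    (fun i => weight Sd (k - q) i) 0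
  have h1 := close_choosingMech hε hε1 hδ hδ1 (Δ := 16 * d) (Z := Finset.range (2 ^ q))
    (by push_cast; linarith) (fun i _ => hw (k - q) i) (fun i _ => hw' (k - q) i)
    ((sum_weight_le Sd _ _).trans hc) ((sum_weight_le Sd' _ _).trans hc') hTδ 0
  refine (Close.bind Measurable.of_discrete Measurable.of_discrete
    (fun _ => isProbabilityMeasure_expMech _ (Finset.insert_nonempty _ _) _) h1
    (fun i => close_expMech hε.le _ fun z _ => hSb.abs_fIPP z)).mono ?_ (by rw [add_zero])
  rw [← lossFactor_add]
  refine lossFactor_mono (le_of_eq ?_)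
  push_cast; ring

/-! ### One level of the recursion -/

/-- The data set after the removal of the `t` smallest elements. -/
noncomputable def dropSmall (t : ℕ) (D : Multiset ℕ) : Multiset ℕ :=
  ↑((D.sort (fun a b => a ≤ b)).drop t)

/-- The data set after the removal of the `t` smallest, then of the `t` largest elements. -/
noncomputable def core (t : ℕ) (D : Multiset ℕ) : Multiset ℕ :=
  ↑(((dropSmall t D).sort (fun a b => b ≤ a)).drop t)

/-- The elements removed in `core`. -/
noncomputable def border (t : ℕ) (D : Multiset ℕ) : Multiset ℕ :=
  ↑((D.sort (fun a b => a ≤ b)).take t) + ↑(((dropSmall t D).sort (fun a b => b ≤ a)).take t)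

lemma newTreeLog_of_not_le (ε δ : ℝ) (t : ℕ) (ρ : ℝ) {N : ℕ} (hN : ¬ N ≤ 8) (D : Multiset ℕ) :
    newTreeLog ε δ t ρ N D = ((lap (1 / ε)).bind fun s =>
      if 3 * (t : ℝ) / 4 + ρ ≤ (Gam (Nat.clog 2 N) (core t D) : ℝ) + s then
        oneHeavyRound ε t (Nat.clog 2 N) (core t D)
      else (newTreeLog ε δ t ρ (Nat.clog 2 N) (tailLabels (2 * t) (Nat.clog 2 N) (core t D))).bind
        (finishLevel ε δ (Nat.clog 2 N) (headSlice (2 * t) (Nat.clog 2 N) (core t D))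
          (border t D))).map fun z => min z (N - 1) := by
  rw [newTreeLog, dif_neg hN]
  rfl

lemma TailClose.core {d : ℕ} {D D' : Multiset ℕ} (h : TailClose d D D') (t : ℕ) :
    TailClose d (core t D) (core t D') := (h.drop_sort_le t).drop_sort_ge t

lemma TailClose.border {d : ℕ} {D D' : Multiset ℕ} (h : TailClose d D D') (t : ℕ) :
    TailClose (2 * d) (border t D) (border t D') :=
  two_mul d ▸ (h.take_sort_le t).add ((h.drop_sort_le t).take_sort_ge t)

lemma mem_of_mem_core {t x : ℕ} {D : Multiset ℕ} (h : x ∈ core t D) : x ∈ D := by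
  have := List.mem_of_mem_drop (Multiset.mem_coe.1 h)
  rw [Multiset.mem_sort] at this
  have := List.mem_of_mem_drop (Multiset.mem_coe.1 this)
  rwa [Multiset.mem_sort] at this

lemma card_core_le (t : ℕ) (D : Multiset ℕ) : (core t D).card ≤ D.card := by
  simp [core, dropSmall]
  omega

/-- The number of recursive calls of `newTreeLog` on a universe of size `N`. -/
def recDepth (N : ℕ) : ℕ := if _h : N ≤ 8 then 0 else recDepth (Nat.clog 2 N) + 1
termination_by N
decreasing_by exact clog_lt_self _h

/-- The condition on `d * 2 ^ recDepth N` survives the doubling of `d` and keeps `ε d ≤ 1` at every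
level. The same `m` serves throughout, because the data sets never grow. -/
lemma close_newTreeLog {ε δ : ℝ} (hε : 0 < ε) (hε1 : ε ≤ 1) (hδ : 0 < δ) (hδ1 : δ ≤ Real.exp (-10))
    {t : ℕ} (hγ : lossFactor (-(ε * t / 20)) ≤ ENNReal.ofReal δ) (hεt : 1000 ≤ ε * t)
    (htδ : ε * t * δ ≤ 101) {ρ : ℝ} (hρ : |ρ| ≤ (t : ℝ) / 20) (m N : ℕ) :
    0 < N → ∀ (d : ℕ) (D D' : Multiset ℕ), TailClose d D D' → (∀ x ∈ D, x < N) →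
      (∀ x ∈ D', x < N) → 20 * D.card ≤ m * t → ε * (d * 2 ^ recDepth N) ≤ 1 →
      Close (lossFactor (16 * d * ε * (2 ^ (recDepth N + 1) - 1)))
        ((recDepth N + 1 : ℕ) * ((m + 1000000) * ENNReal.ofReal δ))
        (newTreeLog ε δ t ρ N D) (newTreeLog ε δ t ρ N D') := by
  induction N using Nat.strong_induction_on with
  | _ N ih =>
  intro hN d D D' hD hDN hDN' hm hd
  have hb : 0 < 1 / ε := one_div_pos.2 hε
  have hlap := isProbabilityMeasure_lap hb
  by_cases h8 : N ≤ 8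
  · rw [newTreeLog, newTreeLog, dif_pos h8, dif_pos h8]
    have hr : recDepth N = 0 := by rw [recDepth, dif_pos h8]
    refine (close_expMech hε.le _ fun z _ => hD.abs_fIPP z).mono (lossFactor_mono ?_) zero_le
    rw [hr]
    have : 0 ≤ ε * d := by positivity
    norm_num
    linarith
  set k := Nat.clog 2 N with hk
  have hr : recDepth N = recDepth k + 1 := by rw [recDepth, dif_neg h8]
  set r := recDepth k
  have hk0 : 0 < k := Nat.clog_pos one_lt_two (by omega)
  have hNk : N ≤ 2 ^ k := Nat.le_pow_clog one_lt_two N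
  have hd1 : ε * d ≤ 1 := by
    refine le_trans ?_ hd
    gcongr
    exact le_mul_of_one_le_right (by positivity) (one_le_pow₀ (by norm_num))
  have htr : (0 : ℝ) < t := by
    by_contra h
    have : ε * t ≤ 0 := mul_nonpos_of_nonneg_of_nonpos hε.le (not_lt.1 h)
    linarith
  have ht : 0 < t := by exact_mod_cast htr
  have hdt' : 1000 * (d : ℝ) ≤ t := by
    by_contra h
    have := mul_lt_mul_of_pos_left (not_le.1 h) hε
    linarith
  have hdt : 1000 * d ≤ t := by exact_mod_cast hdt'
  have hC := hD.core t
  have hB := hD.border t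
  have hCk : ∀ x ∈ core t D, x < 2 ^ k := fun x hx => (hDN x (mem_of_mem_core hx)).trans_le hNk
  have hCk' : ∀ x ∈ core t D', x < 2 ^ k := fun x hx => (hDN' x (mem_of_mem_core hx)).trans_le hNk
  have hCm : 20 * (core t D).card ≤ m * t :=
    (Nat.mul_le_mul_left _ (card_core_le t D)).trans hm
  rw [newTreeLog_of_not_le _ _ _ _ h8, newTreeLog_of_not_le _ _ _ _ h8, ← hk]
  refine Close.map Measurable.of_discrete ?_
  have mtest : ∀ c : ℝ, MeasurableSet {s : ℝ | 3 * (t : ℝ) / 4 + ρ ≤ c + s} := fun c =>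
    measurableSet_le measurable_const (measurable_const.add measurable_id)
  intro g hg hg1
  rw [lintegral_bind_ite _ (mtest _) _ _ hg, lintegral_bind_ite _ (mtest _) _ _ hg]
  have hG : (Gam k (core t D) : ℝ) ≤ Gam k (core t D') + 2 * d := by
    exact_mod_cast hC.gammaFrom k 0
  have hG' : (Gam k (core t D') : ℝ) ≤ Gam k (core t D) + 2 * d := by
    exact_mod_cast hC.symm.gammaFrom k 0
  set G := Gam k (core t D) with hGdef
  set G' := Gam k (core t D') with hGdef'
  have hshift : |2 * (d : ℝ)| / (1 / ε) ≤ 2 * d * ε := by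
    rw [abs_of_nonneg (by positivity), div_div_eq_mul_div, div_one]
  have hshift' : |(-(2 * (d : ℝ)))| / (1 / ε) ≤ 2 * d * ε := by rwa [abs_neg]
  have p1 := lap_shift_const_le hb (mtest G) (mtest G') (2 * d) (fun s hs => by
    simp only [Set.mem_ofPred_eq] at hs ⊢; linarith) hshift
  have p2 := lap_shift_const_le hb (mtest G).compl (mtest G').compl (-(2 * d)) (fun s hs => by
    simp only [Set.mem_compl_iff, Set.mem_ofPred_eq, not_le] at hs ⊢; linarith) hshift'
  obtain ⟨hρ1, hρ2⟩ := abs_le.1 hρ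
  have tail_eq : -((t : ℝ) / 20) / (1 / ε) = -(ε * t / 20) := by field_simp
  have hdε : 0 ≤ (d : ℝ) * ε := by positivity
  have hpow : (1 : ℝ) ≤ 2 ^ r := one_le_pow₀ (by norm_num)
  have hprobO := isProbabilityMeasure_oneHeavyRound hε t k (core t D)
  have hNT := (newTreeLog_props hε δ t k hk0 (tailLabels (2 * t) k (core t D))).2 ρ
  have hfin : ∀ q, IsProbabilityMeasure (finishLevel ε δ k (headSlice (2 * t) k (core t D))
    (border t D) q) := fun q => isProbabilityMeasure_finishLevel hε _ _ _ _ q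
  have hprobR := isProbabilityMeasure_bind' (μ := newTreeLog ε δ t ρ k
    (tailLabels (2 * t) k (core t D))) Measurable.of_discrete hfin
  -- The loss of a level splits into the test of `Γ`, the recursive call at distance `2 * d`, and
  -- the finishing steps.
  have hEtot : 16 * (d : ℝ) * ε * (2 ^ (recDepth N + 1) - 1) =
      2 * d * ε + (16 * (2 * d : ℕ) * ε * (2 ^ (r + 1) - 1) + 14 * d * ε) := by
    rw [hr]; push_cast; ring
  have hE0 : 0 ≤ 16 * ((2 * d : ℕ) : ℝ) * ε * (2 ^ (r + 1) - 1) := by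
    have : (0 : ℝ) ≤ 2 ^ (r + 1) - 1 := by rw [pow_succ]; linarith
    positivity
  have hpart1 : lap (1 / ε) {s | 3 * (t : ℝ) / 4 + ρ ≤ G + s} *
      ∫⁻ z, g z ∂(oneHeavyRound ε t k (core t D)) ≤
      lossFactor (16 * d * ε * (2 ^ (recDepth N + 1) - 1)) *
        (lap (1 / ε) {s | 3 * (t : ℝ) / 4 + ρ ≤ G' + s} *
          ∫⁻ z, g z ∂(oneHeavyRound ε t k (core t D'))) + (m + 3) * ENNReal.ofReal δ := by
    -- Below `9t/20` this branch needs noise of at least `t/20`, even if `ρ = -t/20`.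
    by_cases h9 : 9 * t ≤ 20 * G
    · have hO := close_oneHeavyRound hε hC hγ ht (by omega) h9 hCm g hg hg1
      refine (mul_le_of_close p1 prob_le_one hO).trans ?_
      gcongr
      rw [← lossFactor_add, hEtot]
      exact lossFactor_mono (by linarith)
    · have h9' : 20 * (G : ℝ) < 9 * t := by exact_mod_cast not_le.1 h9
      refine (mul_le_of_small (le_trans ?_ hγ) (lintegral_le_one _ hg1)).trans
        (add_le_add_right (le_mul_of_one_le_left' ?_) _)
      · rw [← tail_eq]
        refine lap_upper_tail hb (mtest G) (by positivity) fun s hs => ?_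
        simp only [Set.mem_ofPred_eq] at hs
        linarith
      · exact le_add_left (by norm_num)
  have hpart2 : lap (1 / ε) {s | ¬ 3 * (t : ℝ) / 4 + ρ ≤ G + s} *
      ∫⁻ z, g z ∂((newTreeLog ε δ t ρ k (tailLabels (2 * t) k (core t D))).bind
        (finishLevel ε δ k (headSlice (2 * t) k (core t D)) (border t D))) ≤
      lossFactor (16 * d * ε * (2 ^ (recDepth N + 1) - 1)) *
        (lap (1 / ε) {s | ¬ 3 * (t : ℝ) / 4 + ρ ≤ G' + s} *
        ∫⁻ z, g z ∂((newTreeLog ε δ t ρ k (tailLabels (2 * t) k (core t D'))).bind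
          (finishLevel ε δ k (headSlice (2 * t) k (core t D')) (border t D')))) +
      ((r + 1 : ℕ) * ((m + 1000000) * ENNReal.ofReal δ) + ENNReal.ofReal (700000 * δ)) := by
    -- Since `1000 * d ≤ t`, this gives `2 * G + 6 * d ≤ 2 * t`, the hypothesis of
    -- `exists_commonPath`. Otherwise, even if `ρ = t/20`, the branch needs noise below `-t/20`.
    by_cases h17 : 20 * G ≤ 17 * t
    · obtain ⟨J, hJ⟩ := exists_commonPath (T := 2 * t) hk0 hC (by omega)
      have hrec := ih k (clog_lt_self h8) hk0 (2 * d) _ _ (hC.tailLabels hJ hCk hCk')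
        (fun x hx => lt_of_mem_tailLabels hk0 hx) (fun x hx => lt_of_mem_tailLabels hk0 hx)
        (le_trans (Nat.mul_le_mul_left _ (by rw [card_tailLabels]; omega)) hCm)
        (by rw [hr] at hd; push_cast; rw [pow_succ] at hd; linarith)
      have hcomp := Close.bind Measurable.of_discrete Measurable.of_discrete hfin hrec
        (fun q => close_finishLevel (T := 2 * t) hε hε1 hδ hδ1 hd1 (by push_cast; linarith) k
          (hC.weight_headSlice (by omega) hJ hCk hCk')
          (hC.symm.weight_headSlice (by omega) hJ.symm hCk' hCk)
          (by rw [card_headSlice]; omega) (by rw [card_headSlice]; omega) hB q) g hg hg1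
      rw [hEtot, lossFactor_add, lossFactor_add]
      exact mul_le_of_close p2 prob_le_one hcomp
    · have h17' : 17 * (t : ℝ) < 20 * G := by exact_mod_cast not_le.1 h17
      refine (mul_le_of_small (le_trans ?_ hγ) (lintegral_le_one _ hg1)).trans
        (add_le_add_right ?_ _)
      · rw [← tail_eq]
        refine lap_lower_tail hb (mtest G).compl (by positivity) fun s hs => ?_
        simp only [Set.mem_ofPred_eq, Set.mem_compl_iff, not_le] at hs
        linarith
      · exact le_add_left (ENNReal.ofReal_le_ofReal (by linarith))
  refine (mix_le hpart1 hpart2).trans (add_le_add_right ?_ _)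
  have h7 : ENNReal.ofReal (700000 * δ) = 700000 * ENNReal.ofReal δ := by
    rw [ENNReal.ofReal_mul (by norm_num)]; norm_num
  rw [hr, h7]
  calc _ = (r + 1 : ℕ) * ((m + 1000000) * ENNReal.ofReal δ) +
        (m + 700003) * ENNReal.ofReal δ := by ring
    _ ≤ (r + 1 : ℕ) * ((m + 1000000) * ENNReal.ofReal δ) +
        (m + 1000000) * ENNReal.ofReal δ := by gcongr; norm_num
    _ = _ := by push_cast; ring

/-! ### The depth of the recursion -/

/-- Rounding up commutes with the logarithm because the powers `2 ^ y` are integers. The rounded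
universe sizes thus follow the real iterates. -/
lemma clog_ceil {x : ℝ} (hx : 1 ≤ x) : Nat.clog 2 ⌈x⌉₊ = ⌈Real.logb 2 x⌉₊ := by
  refine eq_of_forall_ge_iff fun y => ?_
  rw [Nat.clog_le_iff_le_pow one_lt_two, Nat.ceil_le, Nat.ceil_le,
    Real.logb_le_iff_le_rpow one_lt_two (by linarith), Real.rpow_natCast]
  push_cast; rfl

lemma recDepth_le_of_iterate (k : ℕ) : ∀ x : ℝ, (Real.logb 2)^[k] x ≤ 1 →
    recDepth ⌈x⌉₊ ≤ k := by
  induction k with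
  | zero =>
    intro x hx
    have : ⌈x⌉₊ ≤ 1 := Nat.ceil_le.2 (by simpa using hx)
    rw [recDepth, dif_pos (by omega)]
  | succ k ih =>
    intro x hx
    by_cases h8 : ⌈x⌉₊ ≤ 8
    · rw [recDepth, dif_pos h8]; exact Nat.zero_le _
    · have h8' : 1 ≤ x := by
        by_contra h
        exact h8 (Nat.ceil_le.2 (by push_cast; linarith))
      rw [recDepth, dif_neg h8, clog_ceil h8']
      exact Nat.succ_le_succ (ih _ hx)

/-- Ensures that the infimum defining `logStar` is attained, rather than being the default value `0`
of an empty set. -/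
lemma exists_iterate_logb_le_one (n : ℕ) : ∀ x : ℝ, x ≤ n → ∃ k, (Real.logb 2)^[k] x ≤ 1 := by
  induction n with
  | zero => exact fun x hx => ⟨0, by simp at hx ⊢; linarith⟩
  | succ n ih =>
    intro x hx
    rcases le_or_gt x 1 with h1 | h1
    · exact ⟨0, h1⟩
    · obtain ⟨k, hk⟩ := ih (Real.logb 2 x) (by
        rw [Real.logb_le_iff_le_rpow one_lt_two (by linarith), Real.rpow_natCast]
        refine hx.trans ?_
        exact_mod_cast Nat.succ_le_of_lt Nat.lt_two_pow_self)
      exact ⟨k + 1, hk⟩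

lemma recDepth_le_logStar (N : ℕ) : recDepth N ≤ logStar N := by
  have h := Nat.sInf_mem (s := {k : ℕ | (Real.logb 2)^[k] (N : ℝ) ≤ 1})
    (exists_iterate_logb_le_one N N le_rfl)
  have := recDepth_le_of_iterate _ _ h
  rwa [Nat.ceil_natCast] at this

/-! ### Positions -/

lemma measurable_ofPos {X : Type*} [LinearOrder X] [Fintype X] [Nonempty X] [MeasurableSpace X] :
    Measurable (ofPos : ℕ → X) := Measurable.of_discrete

lemma pos_lt {X : Type*} [LinearOrder X] [Fintype X] (x : X) : pos x < Fintype.card X :=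
  Fin.isLt _

lemma pos_le_iff {X : Type*} [LinearOrder X] [Fintype X] [Nonempty X] (x : X) (y : ℕ) :
    pos x ≤ y ↔ x ≤ ofPos y := by
  have h := pos_lt x
  rw [ofPos, ← OrderIso.symm_apply_le, Fin.le_def]
  change pos x ≤ y ↔ pos x ≤ min y _
  omega

lemma CumAdjacent.tailClose {X : Type*} [LinearOrder X] [Fintype X] [Nonempty X]
    {D D' : Multiset X} (h : CumAdjacent D D') : TailClose 1 (D.map pos) (D'.map pos) := by
  refine TailClose.of_countP_le (by simpa using h.1) fun y => ?_
  have key : ∀ E : Multiset X, (E.map pos).countP (fun x => x ≤ y) =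
      E.countP (fun x => x ≤ ofPos y) := fun E => by
    rw [Multiset.countP_map, ← Multiset.countP_eq_card_filter]
    exact countP_congr_mem E fun x _ => pos_le_iff x y
  rw [key, key]
  have := abs_le.1 (h.2 (ofPos y))
  omega

/-! ### Parameters -/

/-- Rescaling the variable by `log 2` reduces this to the decay of polynomial over exponential; a
convergent sequence is bounded. -/
lemma exists_polynomial_le_two_pow (R : Polynomial ℝ) :
    ∃ B : ℝ, 0 < B ∧ ∀ n : ℕ, R.eval (n : ℝ) ≤ B * 2 ^ n := by
  have hl : 0 < Real.log 2 := Real.log_pos one_lt_two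
  have h1 := (Polynomial.tendsto_div_exp_atTop
    (R.comp (Polynomial.C (Real.log 2)⁻¹ * Polynomial.X))).comp
    (tendsto_natCast_atTop_atTop.atTop_mul_const hl)
  obtain ⟨B, hB⟩ := h1.bddAbove_range
  refine ⟨max B 1, by positivity, fun n => ?_⟩
  have h2 := hB ⟨n, rfl⟩
  have h3 : Real.exp (n * Real.log 2) = 2 ^ n := by
    rw [Real.exp_nat_mul, Real.exp_log two_pos]
  simp only [Function.comp_apply, Polynomial.eval_comp, Polynomial.eval_mul, Polynomial.eval_C,
    Polynomial.eval_X, h3] at h2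
  rw [mul_comm (n : ℝ), inv_mul_cancel_left₀ hl.ne', div_le_iff₀ (by positivity)] at h2
  exact h2.trans (by gcongr; exact le_max_left _ _)

lemma exists_error_bound (P : Polynomial ℝ) : ∃ B : ℝ, 0 < B ∧ ∀ L : ℕ,
    ((L : ℝ) + 1) * (⌈20 * |P.eval (L : ℝ)|⌉₊ + 1000002) ≤ B * 2 ^ L := by
  -- `P ^ 2 + 1` is a polynomial majorant of `|P|`, and the increase from `1000002` to `1000003`
  -- pays for the ceiling.
  obtain ⟨B, hB, h⟩ := exists_polynomial_le_two_pow
    ((Polynomial.X + 1) * (20 * (P ^ 2 + 1) + 1000003))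
  refine ⟨B, hB, fun L => le_trans ?_ (h L)⟩
  have h1 := (Nat.ceil_lt_add_one (show 0 ≤ 20 * |P.eval (L : ℝ)| by positivity)).le
  have h2 : |P.eval (L : ℝ)| ≤ P.eval (L : ℝ) ^ 2 + 1 := by
    nlinarith [sq_abs (P.eval (L : ℝ)), sq_nonneg (|P.eval (L : ℝ)| - 1)]
  simp only [Polynomial.eval_mul, Polynomial.eval_add, Polynomial.eval_pow, Polynomial.eval_X,
    Polynomial.eval_one, Polynomial.eval_ofNat]
  gcongr ((L : ℝ) + 1) * ?_
  linarith

lemma trim_bounds {ε δ : ℝ} (hε : 0 < ε) (hε1 : ε ≤ 1) (hδ : 0 < δ) (hδ1 : δ ≤ Real.exp (-10)) :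
    lossFactor (-(ε * trim ε δ / 20)) ≤ ENNReal.ofReal δ ∧ 1000 ≤ ε * trim ε δ ∧
      ε * trim ε δ * δ ≤ 101 := by
  set l := Real.log (1 / δ) with hl
  have hlδ : Real.exp (-l) = δ := by
    rw [hl, one_div, Real.log_inv, neg_neg, Real.exp_log hδ]
  have hl10 : 10 ≤ l := by
    rw [← hlδ, Real.exp_le_exp] at hδ1; linarith
  have hδle : δ ≤ 1 := hδ1.trans (Real.exp_le_one_iff.2 (by norm_num))
  have h1 : 100 / ε * l ≤ trim ε δ := Nat.le_ceil _
  have h2 : (trim ε δ : ℝ) ≤ 100 / ε * l + 1 :=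
    (Nat.ceil_lt_add_one (by positivity)).le
  have h1' : 100 * l ≤ ε * trim ε δ := by
    calc 100 * l = ε * (100 / ε * l) := by field_simp
      _ ≤ _ := by gcongr
  have h2' : ε * trim ε δ ≤ 100 * l + ε := by
    calc ε * trim ε δ ≤ ε * (100 / ε * l + 1) := by gcongr
      _ = _ := by field_simp
  have h3 : l * δ ≤ 1 := by
    have := Real.log_le_self (show 0 ≤ 1 / δ by positivity)
    rwa [← hl, le_div_iff₀ hδ] at this
  refine ⟨ENNReal.ofReal_le_ofReal ?_, by linarith, ?_⟩
  · calc Real.exp (-(ε * trim ε δ / 20)) ≤ Real.exp (-l) := Real.exp_le_exp.2 (by linarith)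
      _ = δ := hlδ
  · calc ε * trim ε δ * δ ≤ (100 * l + ε) * δ := by gcongr
      _ = 100 * (l * δ) + ε * δ := by ring
      _ ≤ 100 * 1 + 1 * 1 := by gcongr
      _ = 101 := by norm_num

/-! ### Averaging over the global threshold noise -/

lemma close_cumTreeLogPos {ε δ : ℝ} (hε : 0 < ε) (hε1 : ε ≤ 1) (hδ : 0 < δ)
    (hδ1 : δ ≤ Real.exp (-10)) {m N : ℕ} (hN : 0 < N) {D D' : Multiset ℕ} (hD : TailClose 1 D D')
    (hDN : ∀ x ∈ D, x < N) (hDN' : ∀ x ∈ D', x < N) (hm : 20 * D.card ≤ m * trim ε δ)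
    (hd : ε * 2 ^ recDepth N ≤ 1) :
    Close (lossFactor (16 * ε * (2 ^ (recDepth N + 1) - 1)))
      ((recDepth N + 1 : ℕ) * ((m + 1000002) * ENNReal.ofReal δ))
      (cumTreeLogPos ε δ N D) (cumTreeLogPos ε δ N D') := by
  have hb : 0 < 1 / ε := one_div_pos.2 hε
  have hlap := isProbabilityMeasure_lap hb
  obtain ⟨hγ, hεt, htδ⟩ := trim_bounds hε hε1 hδ hδ1
  set t := trim ε δ
  have hp := newTreeLog_props hε δ t N hN
  intro g hg hg1
  have hmeas : ∀ E, Measurable fun ρ => ∫⁻ z, g z ∂(newTreeLog ε δ t ρ N E) := fun E =>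
    (Measure.measurable_lintegral hg).comp (hp E).1
  rw [cumTreeLogPos, cumTreeLogPos, Measure.lintegral_bind (hp D).1.aemeasurable hg.aemeasurable,
    Measure.lintegral_bind (hp D').1.aemeasurable hg.aemeasurable]
  have step := lintegral_le_indicator (lap (1 / ε)) (β := 2 * ENNReal.ofReal δ)
    (G := fun ρ => ∫⁻ z, g z ∂(newTreeLog ε δ t ρ N D))
    (H := fun ρ => lossFactor (16 * ε * (2 ^ (recDepth N + 1) - 1)) *
      ∫⁻ z, g z ∂(newTreeLog ε δ t ρ N D'))
    (e := (recDepth N + 1 : ℕ) * ((m + 1000000) * ENNReal.ofReal δ))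
    (B := {ρ : ℝ | ¬ |ρ| ≤ (t : ℝ) / 20})
    ((measurableSet_le measurable_norm measurable_const).compl)
    ((lap_abs_tail hε (by positivity)).trans (by rw [← mul_div_assoc]; gcongr))
    (fun ρ => have := (hp D).2 ρ; lintegral_le_one _ hg1)
    ((hmeas D').const_mul _)
    (fun ρ hρ => by
      have := close_newTreeLog hε hε1 hδ hδ1 hγ hεt htδ (not_not.1 hρ) m N hN 1 D D' hD hDN hDN' hm
        (by simpa using hd) g hg hg1
      simpa using this)
  refine step.trans ?_
  rw [lintegral_const_mul _ (hmeas D')]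
  refine add_le_add_right ?_ _
  calc _ ≤ (recDepth N + 1 : ℕ) * ((m + 1000000) * ENNReal.ofReal δ) +
        (recDepth N + 1 : ℕ) * (2 * ENNReal.ofReal δ) := by
        refine add_le_add le_rfl (le_mul_of_one_le_left' ?_)
        exact_mod_cast Nat.le_add_left 1 (recDepth N)
    _ = _ := by ring

end CumDP

/-! ### The main theorem -/

theorem mainTheorem8 (P : Polynomial ℝ) :
    ∃ C : ℝ, 0 < C ∧
      ∀ (X : Type*) [LinearOrder X] [Fintype X] [Nonempty X]
        [MeasurableSpace X] [DiscreteMeasurableSpace X] (ε δ : ℝ) (n : ℕ),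
        0 < ε → ε < (2 : ℝ) ^ (-(logStar (Fintype.card X) : ℝ)) → 0 < δ →
        (n : ℝ) ≤ (CumDP.trim ε δ : ℝ) * P.eval (logStar (Fintype.card X) : ℝ) →
        CumDP.IsCumDP n
          (C * (ε * 2 ^ logStar (Fintype.card X)))
          (C * (δ * 2 ^ logStar (Fintype.card X)))
          (CumDP.cumTreeLog X ε δ) := by
  obtain ⟨B, hB, hBL⟩ := CumDP.exists_error_bound P
  -- `32` serves the privacy loss, `B` the additive error for small `δ`, and `exp 10` makes the
  -- additive error at least `1` when `δ > exp (-10)`.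
  refine ⟨B + 32 + Real.exp 10, by positivity, ?_⟩
  intro X _ _ _ _ _ ε δ n hε hεL hδ hn D D' hDn _ hadj
  have hr := CumDP.recDepth_le_logStar (Fintype.card X)
  set N := Fintype.card X
  set L := logStar (N : ℝ)
  have h2L : (1 : ℝ) ≤ 2 ^ L := one_le_pow₀ (by norm_num)
  rw [Real.rpow_neg two_pos.le, Real.rpow_natCast] at hεL
  have hεL' : ε * 2 ^ L ≤ 1 := by
    have := (mul_lt_mul_of_pos_right hεL (show (0 : ℝ) < 2 ^ L by positivity)).le
    rwa [inv_mul_cancel₀ (by positivity)] at this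
  have hε1 : ε ≤ 1 := (le_mul_of_one_le_right hε.le h2L).trans hεL'
  have he10 := Real.exp_pos 10
  refine CumDP.Close.indist ?_
  rcases le_or_gt δ (Real.exp (-10)) with hδ1 | hδ1
  · refine CumDP.Close.map CumDP.measurable_ofPos ?_
    -- The budget `m` is chosen as `20 |P(L)|` rounded up; the absolute value covers negative values
    -- of `P`.
    have hcard : 20 * (D.map CumDP.pos).card ≤
        ⌈20 * |P.eval (L : ℝ)|⌉₊ * CumDP.trim ε δ := by
      rw [Multiset.card_map, hDn]
      have h1 : (20 * n : ℝ) ≤ ⌈20 * |P.eval (L : ℝ)|⌉₊ * CumDP.trim ε δ := by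
        calc (20 * n : ℝ) ≤ 20 * (CumDP.trim ε δ * P.eval (L : ℝ)) := by gcongr
          _ ≤ 20 * (CumDP.trim ε δ * |P.eval (L : ℝ)|) := by gcongr; exact le_abs_self _
          _ = (20 * |P.eval (L : ℝ)|) * CumDP.trim ε δ := by ring
          _ ≤ _ := by gcongr; exact Nat.le_ceil _
      exact_mod_cast h1
    have hlt : ∀ E : Multiset X, ∀ x ∈ E.map CumDP.pos, x < N := fun E x hx => by
      obtain ⟨y, _, rfl⟩ := Multiset.mem_map.1 hx
      exact CumDP.pos_lt y
    have h2r : (2 : ℝ) ^ CumDP.recDepth N ≤ 2 ^ L := pow_le_pow_right₀ (by norm_num) hr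
    refine (CumDP.close_cumTreeLogPos hε hε1 hδ hδ1 Fintype.card_pos hadj.tailClose (hlt D) (hlt D')
      hcard (le_trans (by gcongr) hεL')).mono (CumDP.lossFactor_mono ?_) ?_
    · calc 16 * ε * (2 ^ (CumDP.recDepth N + 1) - 1) ≤ 16 * ε * (2 ^ L * 2) := by
            gcongr
            rw [pow_succ]
            linarith
        _ = 32 * (ε * 2 ^ L) := by ring
        _ ≤ _ := by gcongr; linarith
    · rw [← ENNReal.ofReal_natCast, ← ENNReal.ofReal_natCast (⌈20 * |P.eval (L : ℝ)|⌉₊),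
        show (1000002 : ENNReal) = ENNReal.ofReal 1000002 by norm_num,
        ← ENNReal.ofReal_add (by positivity) (by positivity),
        ← ENNReal.ofReal_mul (by positivity), ← ENNReal.ofReal_mul (by positivity)]
      refine ENNReal.ofReal_le_ofReal ?_
      have hr' : ((CumDP.recDepth N + 1 : ℕ) : ℝ) ≤ (L : ℝ) + 1 := by exact_mod_cast Nat.succ_le_succ hr
      calc _ ≤ ((L : ℝ) + 1) * ((⌈20 * |P.eval (L : ℝ)|⌉₊ + 1000002) * δ) := by gcongr
        _ = ((L : ℝ) + 1) * (⌈20 * |P.eval (L : ℝ)|⌉₊ + 1000002) * δ := by ring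
        _ ≤ B * 2 ^ L * δ := mul_le_mul_of_nonneg_right (hBL L) hδ.le
        _ = B * (δ * 2 ^ L) := by ring
        _ ≤ _ := by gcongr; linarith
  · have := CumDP.isProbabilityMeasure_cumTreeLog X hε δ D
    refine CumDP.Close.of_one_le ?_
    rw [ENNReal.one_le_ofReal]
    calc (1 : ℝ) = Real.exp 10 * (Real.exp (-10) * 1) := by
          rw [mul_one, ← Real.exp_add]; norm_num
      _ ≤ (B + 32 + Real.exp 10) * (δ * 2 ^ L) := by
          gcongr
          linarith
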